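/- Let $n\ge 2$, let $\Gamma\subset\mathbb{R}^n$ be compact, and suppose that $\mathrm{int}(\Gamma)$, the interior of $\Gamma$, is non-empty. Then, given any $k_0>0$, there exists $c'>0$ such that $$\|A_{k,k}\|_k\ \ge\ c'k,\qquad k\ge k_0 .$$ Here the notation is as follows. For $s\in\mathbb{R}$ and $k>0$, $H^s(\mathbb{R}^n)$ is the space of tempered distributions $u$ whose Fourier transform $\hat u$ (normalised to be unitary on $L^2(\mathbb{R}^n)$) is locally integrable with $\|u\|_{H^s_k(\mathbb{R}^n)}:=\big(\int_{\mathbb{R}^n}|\hat u(\xi)|^2(k^2+|\xi|^2)^s\,d\xi\big)^{1/2}<\infty$ (as a set it does not depend on $k$); $H^{-1}_\Gamma:=\{\psi\in H^{-1}(\mathbb{R}^n):\mathrm{supp}(\psi)\subset\Gamma\}$; with $\Gamma^c:=\mathbb{R}^n\setminus\Gamma$, $\widetilde H^1(\Gamma^c)$ is the closure of $C_0^\infty(\Gamma^c)$ in $H^1(\mathbb{R}^n)$; and $P_k$ is the orthogonal projection of $H^1(\mathbb{R}^n)$, equipped with the inner product of $\|\cdot\|_{H^1_k(\mathbb{R}^n)}$,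 onto the orthogonal complement $\widetilde H^1(\Gamma^c)^{\perp_k}$ of $\widetilde H^1(\Gamma^c)$. The acoustic Newtonian potential $\mathcal{A}_k$ is $$\mathcal{A}_k\psi(x)=\int_{\mathbb{R}^n}\Phi_k(x,y)\psi(y)\,dy,\qquad \Phi_k(x,y)=\frac{\mathrm{i}}{4}\left(\frac{k}{2\pi|x-y|}\right)^{(n-2)/2}H^{(1)}_{(n-2)/2}(k|x-y|),$$ for compactly supported $\psi\in L^2(\mathbb{R}^n)$, where $H^{(1)}_\nu$ is the Hankel function of the first kind of order $\nu$, extended by continuity to compactly supported $\psi\in H^{-1}(\mathbb{R}^n)$ (for which $\mathcal{A}_k\psi\in H^{1,\mathrm{loc}}(\mathbb{R}^n)$). Finally, $A_{k,k}\psi:=P_k(\chi\mathcal{A}_k\psi)$ for $\psi\in H^{-1}_\Gamma$, where $\chi\in C_0^\infty(\mathbb{R}^n)$ is any function with $\chi=1$ in a neighbourhood of $\Gamma$ ($A_{k,k}$ does not depend on the choice of $\chi$), and $$\|A_{k,k}\|_k:=\sup_{0\ne\psi\in H^{-1}_\Gamma}\frac{\|A_{k,k}\psi\|_{H^1_k(\mathbb{R}^n)}}{\|\psi\|_{H^{-1}_k(\mathbb{R}^n)}}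 .$$ -/

import Mathlib

open MeasureTheory SchwartzMap TemperedDistribution FourierTransform Filter Topology
open scoped ENNReal ContDiff

noncomputable section

namespace Helmholtz

/-- A positive wavenumber. -/
abbrev Wavenumber : Type := {k : ℝ // 0 < k}

/-! ### Sobolev spaces `H^s(ℝⁿ)` with the wavenumber-dependent norms -/

/-- The weight `(k² + |ξ|²)^{s/2}`. In Mathlib's normalisation of the Fourier transform the
frequency variable is `ζ = ξ / (2π)`, so that the weight is written as a function of `ζ`. -/
def weight (n : ℕ) (k : Wavenumber) (s : ℝ) (ζ : EuclideanSpace ℝ (Fin n)) : ℂ :=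
  (((k : ℝ) ^ 2 + (2 * Real.pi * ‖ζ‖) ^ 2) ^ (s / 2) : ℝ)

theorem weight_base_pos (k : Wavenumber) (r : ℝ) : 0 < (k : ℝ) ^ 2 + (2 * Real.pi * r) ^ 2 := by
  have := k.2
  positivity

theorem weight_hasTemperateGrowth (n : ℕ) (k : Wavenumber) (s : ℝ) :
    (weight n k s).HasTemperateGrowth := by
  have hk := k.2
  let L : EuclideanSpace ℝ (Fin n) →L[ℝ] EuclideanSpace ℝ (Fin n) :=
    (2 * Real.pi / (k : ℝ)) • ContinuousLinearMap.id ℝ _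
  have h1 : (fun ζ : EuclideanSpace ℝ (Fin n) => (1 + ‖L ζ‖ ^ 2) ^ (s / 2)).HasTemperateGrowth :=
    (Function.hasTemperateGrowth_one_add_norm_sq_rpow (EuclideanSpace ℝ (Fin n)) (s / 2)).comp
      L.hasTemperateGrowth
  have h2 : (fun ζ : EuclideanSpace ℝ (Fin n) =>
      ((((k : ℝ) ^ 2) ^ (s / 2) : ℝ) : ℂ) * (((1 + ‖L ζ‖ ^ 2) ^ (s / 2) : ℝ) : ℂ)).HasTemperateGrowth := by
    fun_prop
  convert h2 using 2 with ζ
  rw [weight, ← Complex.ofReal_mul, ← Real.mul_rpow (by positivity) (by positivity)]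
  congr 3
  simp only [L, smul_apply, ContinuousLinearMap.id_apply, norm_smul,
    Real.norm_eq_abs, mul_pow, sq_abs]
  field_simp

theorem weight_mul_neg (n : ℕ) (k : Wavenumber) (s : ℝ) :
    weight n k s * weight n k (-s) = fun _ => 1 := by
  ext ζ
  have h := weight_base_pos k ‖ζ‖
  simp only [weight, Pi.mul_apply]
  rw [← Complex.ofReal_mul, ← Real.rpow_add h]
  simp [neg_div]

/-- The weighted Fourier transform `u ↦ (k² + |ξ|²)^{s/2} û` on tempered distributions. -/
def weightedFourier (n : ℕ) (k : Wavenumber) (s : ℝ) :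
    𝓢'(EuclideanSpace ℝ (Fin n), ℂ) →ₗ[ℂ] 𝓢'(EuclideanSpace ℝ (Fin n), ℂ) where
  toFun u := TemperedDistribution.smulLeftCLM ℂ (weight n k s) (𝓕 u)
  map_add' u v := by rw [FourierAdd.fourier_add, map_add]
  map_smul' c u := by rw [FourierSMul.fourier_smul, map_smul]; rfl

theorem smulLeft_weight_smulLeft_weight (n : ℕ) (k : Wavenumber) (s : ℝ)
    (w : 𝓢'(EuclideanSpace ℝ (Fin n), ℂ)) :
    TemperedDistribution.smulLeftCLM ℂ (weight n k s)
      (TemperedDistribution.smulLeftCLM ℂ (weight n k (-s)) w) = w := by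
  rw [TemperedDistribution.smulLeftCLM_smulLeftCLM_apply (weight_hasTemperateGrowth n k (-s))
    (weight_hasTemperateGrowth n k s), mul_comm, weight_mul_neg]
  simp

theorem weightedFourier_injective (n : ℕ) (k : Wavenumber) (s : ℝ) :
    Function.Injective (weightedFourier n k s) := by
  intro u v h
  have h' := congrArg (fun w => 𝓕⁻ (TemperedDistribution.smulLeftCLM ℂ (weight n k (-s)) w)) h
  have h2 := smulLeft_weight_smulLeft_weight n k (-s)
  rw [neg_neg] at h2
  simpa [weightedFourier, h2] using h'

theorem weightedFourier_surjective (n : ℕ) (k : Wavenumber) (s : ℝ) :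
    Function.Surjective (weightedFourier n k s) := by
  intro w
  refine ⟨𝓕⁻ (TemperedDistribution.smulLeftCLM ℂ (weight n k (-s)) w), ?_⟩
  simp [weightedFourier, smulLeft_weight_smulLeft_weight]

/-- Square integrable functions, as tempered distributions. -/
def lTwoToTempered (n : ℕ) :
    Lp ℂ 2 (volume : Measure (EuclideanSpace ℝ (Fin n))) →ₗ[ℂ]
      𝓢'(EuclideanSpace ℝ (Fin n), ℂ) :=
  (Lp.toTemperedDistributionCLM ℂ volume 2 :
    Lp ℂ 2 (volume : Measure (EuclideanSpace ℝ (Fin n))) →L[ℂ]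
      𝓢'(EuclideanSpace ℝ (Fin n), ℂ)).toLinearMap

theorem lTwoToTempered_injective (n : ℕ) : Function.Injective (lTwoToTempered n) :=
  LinearMap.ker_eq_bot.mp (Lp.ker_toTemperedDistributionCLM_eq_bot (F := ℂ) (p := 2))

/-- The tempered distributions `u` for which `(k² + |ξ|²)^{s/2} û` is a square integrable
function. -/
def sobolevSubmodule (n : ℕ) (k : Wavenumber) (s : ℝ) :
    Submodule ℂ 𝓢'(EuclideanSpace ℝ (Fin n), ℂ) :=
  (LinearMap.range (lTwoToTempered n)).comap (weightedFourier n k s)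

/-- The space `H^s_k(ℝⁿ)`: the set `H^s(ℝⁿ)` (as a set it does not depend on `k`) with the Hilbert
space structure `‖u‖² = ∫ |û(ξ)|² (k² + |ξ|²)^s dξ` which is defined below. -/
def SobolevSpace (n : ℕ) (k : Wavenumber) (s : ℝ) : Type :=
  ↥(sobolevSubmodule n k s)

namespace SobolevSpace

variable {n : ℕ} {k : Wavenumber} {s : ℝ}

instance : AddCommGroup (SobolevSpace n k s) :=
  inferInstanceAs (AddCommGroup ↥(sobolevSubmodule n k s))

instance : Module ℂ (SobolevSpace n k s) :=
  inferInstanceAs (Module ℂ ↥(sobolevSubmodule n k s))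

/-- The underlying tempered distribution. -/
def toDistribution : SobolevSpace n k s →ₗ[ℂ] 𝓢'(EuclideanSpace ℝ (Fin n), ℂ) :=
  (sobolevSubmodule n k s).subtype

theorem toDistribution_injective :
    Function.Injective (toDistribution : SobolevSpace n k s → _) :=
  (sobolevSubmodule n k s).injective_subtype

/-- The square integrable function `(k² + |ξ|²)^{s/2} û`, as a function of `ζ = ξ / (2π)`. -/
def symbol : SobolevSpace n k s →ₗ[ℂ] Lp ℂ 2 (volume : Measure (EuclideanSpace ℝ (Fin n))) :=
  (LinearEquiv.ofInjective (lTwoToTempered n) (lTwoToTempered_injective n)).symm.toLinearMap ∘ₗ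
    LinearMap.codRestrict _ (weightedFourier n k s ∘ₗ toDistribution) (fun u => u.2)

theorem lTwoToTempered_symbol (u : SobolevSpace n k s) :
    lTwoToTempered n (symbol u) = weightedFourier n k s (toDistribution u) := by
  have := LinearEquiv.apply_symm_apply
    (LinearEquiv.ofInjective (lTwoToTempered n) (lTwoToTempered_injective n))
    ⟨weightedFourier n k s (toDistribution u), u.2⟩
  exact congrArg Subtype.val this

theorem symbol_injective : Function.Injective (symbol : SobolevSpace n k s → _) := by
  intro u v h
  apply toDistribution_injective
  apply weightedFourier_injective n k s
  rw [← lTwoToTempered_symbol, ← lTwoToTempered_symbol, h]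

theorem symbol_surjective : Function.Surjective (symbol : SobolevSpace n k s → _) := by
  intro f
  obtain ⟨u, hu⟩ := weightedFourier_surjective n k s (lTwoToTempered n f)
  let v : SobolevSpace n k s := (⟨u, ⟨f, hu.symm⟩⟩ : ↥(sobolevSubmodule n k s))
  refine ⟨v, lTwoToTempered_injective n ?_⟩
  rw [lTwoToTempered_symbol]
  exact hu

/-- The norm `‖u‖² = ∫ |û(ξ)|² (k² + |ξ|²)^s dξ`. The change of variables `ξ = 2πζ` cancels the
factor `(2π)^{-n/2}` of the unitary Fourier transform. -/
instance : NormedAddCommGroup (SobolevSpace n k s) :=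
  NormedAddCommGroup.induced _ _ symbol symbol_injective

theorem norm_eq (u : SobolevSpace n k s) : ‖u‖ = ‖symbol u‖ := rfl

instance : InnerProductSpace ℂ (SobolevSpace n k s) where
  norm_smul_le c u := by rw [norm_eq, norm_eq, map_smul, norm_smul]
  inner u v := inner ℂ (symbol u) (symbol v)
  norm_sq_eq_re_inner u := norm_sq_eq_re_inner (𝕜 := ℂ) (symbol u)
  conj_inner_symm u v := inner_conj_symm (𝕜 := ℂ) (symbol u) (symbol v)
  add_left u v w := by rw [map_add, inner_add_left]
  smul_left u v c := by rw [map_smul, inner_smul_left]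

instance : CompleteSpace (SobolevSpace n k s) := by
  let e : SobolevSpace n k s ≃ₗᵢ[ℂ] Lp ℂ 2 (volume : Measure (EuclideanSpace ℝ (Fin n))) :=
    ⟨LinearEquiv.ofBijective symbol ⟨symbol_injective, symbol_surjective⟩, fun _ => rfl⟩
  exact e.toIsometryEquiv.completeSpace

end SobolevSpace

/-- The subspace `H^s_F` of those `u ∈ H^s(ℝⁿ)` with distributional support in `F`. -/
def supportedIn (n : ℕ) (k : Wavenumber) (s : ℝ) (F : Set (EuclideanSpace ℝ (Fin n))) :
    Set (SobolevSpace n k s) :=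
  {u | Distribution.dsupport (u.toDistribution) ⊆ F}

/-- The subspace of `H^s(ℝⁿ)` formed by the smooth functions with compact support in `U`. -/
def testFunctions (n : ℕ) (k : Wavenumber) (s : ℝ) (U : Set (EuclideanSpace ℝ (Fin n))) :
    Submodule ℂ (SobolevSpace n k s) where
  carrier := {u | ∃ φ : 𝓢(EuclideanSpace ℝ (Fin n), ℂ), HasCompactSupport φ ∧ tsupport φ ⊆ U ∧
    u.toDistribution = (φ : 𝓢'(EuclideanSpace ℝ (Fin n), ℂ))}
  zero_mem' := ⟨0, HasCompactSupport.zero, by simp [tsupport], by simp⟩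
  add_mem' := by
    rintro u v ⟨φ, hφ, hφU, hu⟩ ⟨ψ, hψ, hψU, hv⟩
    exact ⟨φ + ψ, hφ.add hψ, (tsupport_add φ ψ).trans (Set.union_subset hφU hψU),
      by rw [map_add, map_add, hu, hv]⟩
  smul_mem' := by
    rintro c u ⟨φ, hφ, hφU, hu⟩
    exact ⟨c • φ, hφ.smul_left (f := fun _ => c),
      (tsupport_smul_subset_right (fun _ => c) φ).trans hφU, by rw [map_smul, map_smul, hu]⟩

/-- The space `H̃^s(U)`, the closure in `H^s(ℝⁿ)` of the smooth functions with compact support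
in `U`. -/
def tildeSpace (n : ℕ) (k : Wavenumber) (s : ℝ) (U : Set (EuclideanSpace ℝ (Fin n))) :
    Submodule ℂ (SobolevSpace n k s) :=
  (testFunctions n k s U).topologicalClosure

instance (n : ℕ) (k : Wavenumber) (s : ℝ) (U : Set (EuclideanSpace ℝ (Fin n))) :
    CompleteSpace ↥(tildeSpace n k s U) :=
  (testFunctions n k s U).isClosed_topologicalClosure.completeSpace_coe

/-- The projection `P_k` of `H^1(ℝⁿ)` onto `H̃^1(Γᶜ)^{⊥_k}`, orthogonal for the inner product of
`H^1_k(ℝⁿ)`. -/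
def projection (n : ℕ) (k : Wavenumber) (Γ : Set (EuclideanSpace ℝ (Fin n))) :
    SobolevSpace n k 1 →L[ℂ] ↥(tildeSpace n k 1 Γᶜ)ᗮ :=
  (tildeSpace n k 1 Γᶜ)ᗮ.orthogonalProjectionOnto

/-! ### The Newtonian potential -/

/-- The Hankel function of the first kind `H_ν^{(1)}(x)`, for `ν > -1/2` and `x > 0`, through
Hankel's classical integral
`H_ν^{(1)}(x) = √(2/(πx)) e^{i(x - νπ/2 - π/4)} / Γ(ν + 1/2) ∫₀^∞ e^{-t} t^{ν-1/2} (1 + it/(2x))^{ν-1/2} dt`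
(principal branch of the power). -/
def hankelOne (ν x : ℝ) : ℂ :=
  (Real.sqrt (2 / (Real.pi * x)) : ℂ) *
    Complex.exp (Complex.I * ((x - ν * Real.pi / 2 - Real.pi / 4 : ℝ) : ℂ)) /
    (Real.Gamma (ν + 1 / 2) : ℂ) *
    ∫ t in Set.Ioi (0 : ℝ), ((Real.exp (-t) * t ^ (ν - 1 / 2) : ℝ) : ℂ) *
      (1 + Complex.I * ((t / (2 * x) : ℝ) : ℂ)) ^ ((ν - 1 / 2 : ℝ) : ℂ)

/-- The radial profile `(i/4) (k / (2πr))^{(n-2)/2} H_{(n-2)/2}^{(1)}(kr)`. -/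
def radialSolution (n : ℕ) (k : Wavenumber) (r : ℝ) : ℂ :=
  Complex.I / 4 * (((k / (2 * Real.pi * r)) ^ (((n : ℝ) - 2) / 2) : ℝ) : ℂ) *
    hankelOne (((n : ℝ) - 2) / 2) (k * r)

/-- The outgoing fundamental solution `Φ_k(x, y)` of the Helmholtz equation `Δu + k²u = 0`. -/
def fundamentalSolution (n : ℕ) (k : Wavenumber) (x y : EuclideanSpace ℝ (Fin n)) : ℂ :=
  radialSolution n k ‖x - y‖


theorem norm_hankel_integrand_le {ν x t : ℝ} (hν : 0 ≤ ν) (hx : 0 < x) (ht : 0 < t) :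
    ‖((Real.exp (-t) * t ^ (ν - 1 / 2) : ℝ) : ℂ) *
      (1 + Complex.I * ((t / (2 * x) : ℝ) : ℂ)) ^ ((ν - 1 / 2 : ℝ) : ℂ)‖ ≤
    (1 + 1 / (2 * x)) ^ ν * (Real.exp (-t) * t ^ (ν - 1 / 2) * (2 ^ ν * (1 + t ^ ν))) := by
  have hq : 0 < t / (2 * x) := by positivity
  set z : ℂ := 1 + Complex.I * ((t / (2 * x) : ℝ) : ℂ) with hz
  have hre : z.re = 1 := by
    rw [hz, Complex.add_re, Complex.one_re, Complex.I_mul_re, Complex.ofReal_im, neg_zero, add_zero]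
  have hz0 : z ≠ 0 := fun h => by rw [h] at hre; simp at hre
  have h1 : 1 ≤ ‖z‖ := by
    have := Complex.abs_re_le_norm z
    rwa [hre, abs_one] at this
  have h2 : ‖z‖ ≤ 1 + t / (2 * x) := by
    refine (norm_add_le _ _).trans ?_
    rw [norm_one, norm_mul, Complex.norm_I, one_mul, Complex.norm_real, Real.norm_eq_abs,
      abs_of_pos hq]
  have h3 : 1 + t / (2 * x) ≤ (1 + 1 / (2 * x)) * (2 * max 1 t) := by
    have : t / (2 * x) = t * (1 / (2 * x)) := by ring
    have hy : 0 < 1 / (2 * x) := by positivity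
    rw [this]
    have := le_max_left 1 t
    have := le_max_right 1 t
    nlinarith
  have h4 : ‖z ^ ((ν - 1 / 2 : ℝ) : ℂ)‖ ≤ (1 + 1 / (2 * x)) ^ ν * (2 ^ ν * (1 + t ^ ν)) := by
    have hm : (max 1 t) ^ ν ≤ 1 + t ^ ν := by
      rcases max_choice 1 t with h | h <;> rw [h]
      · rw [Real.one_rpow]
        have := Real.rpow_nonneg ht.le ν
        linarith
      · linarith
    rw [Complex.norm_cpow_real]
    calc ‖z‖ ^ (ν - 1 / 2) ≤ ‖z‖ ^ ν := Real.rpow_le_rpow_of_exponent_le h1 (by linarith)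
      _ ≤ ((1 + 1 / (2 * x)) * (2 * max 1 t)) ^ ν :=
        Real.rpow_le_rpow (norm_nonneg _) (h2.trans h3) hν
      _ = (1 + 1 / (2 * x)) ^ ν * (2 ^ ν * (max 1 t) ^ ν) := by
        rw [Real.mul_rpow (by positivity) (by positivity),
          Real.mul_rpow (by positivity) (by positivity)]
      _ ≤ _ := by gcongr
  rw [norm_mul, Complex.norm_real, Real.norm_of_nonneg (by positivity)]
  calc _ ≤ _ := mul_le_mul_of_nonneg_left h4 (by positivity)
    _ = _ := by ring

theorem measurable_hankelOne (ν : ℝ) : Measurable (hankelOne ν) := by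
  unfold hankelOne
  refine Measurable.mul (by fun_prop) ?_
  refine StronglyMeasurable.measurable ?_
  refine StronglyMeasurable.integral_prod_right (f := fun x t : ℝ =>
      ((Real.exp (-t) * t ^ (ν - 1 / 2) : ℝ) : ℂ) *
      (1 + Complex.I * ((t / (2 * x) : ℝ) : ℂ)) ^ ((ν - 1 / 2 : ℝ) : ℂ)) ?_
  refine Measurable.stronglyMeasurable ?_
  unfold Function.uncurry
  fun_prop


theorem integrableOn_hankel_majorant {ν : ℝ} (hν : 0 ≤ ν) :
    IntegrableOn (fun t : ℝ => Real.exp (-t) * t ^ (ν - 1 / 2) * (2 ^ ν * (1 + t ^ ν)))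
      (Set.Ioi 0) := by
  have h1 := Real.GammaIntegral_convergent (s := ν + 1 / 2) (by linarith)
  have h2 := Real.GammaIntegral_convergent (s := ν + 1 / 2 + ν) (by linarith)
  have h3 : IntegrableOn (fun t : ℝ => 2 ^ ν * (Real.exp (-t) * t ^ (ν + 1 / 2 - 1) +
      Real.exp (-t) * t ^ (ν + 1 / 2 + ν - 1))) (Set.Ioi 0) := (h1.add h2).const_mul (2 ^ ν)
  refine h3.congr_fun ?_ measurableSet_Ioi
  intro t ht
  have ht : 0 < t := ht
  have e1 : ν + 1 / 2 - 1 = ν - 1 / 2 := by ring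
  have e2 : ν + 1 / 2 + ν - 1 = (ν - 1 / 2) + ν := by ring
  simp only [e1, e2, Real.rpow_add ht]
  ring

/-- A crude bound, with the singularity at the origin that is needed for integrability. -/
theorem norm_hankelOne_le {ν : ℝ} (hν : 0 ≤ ν) :
    ∃ C : ℝ, 0 ≤ C ∧ ∀ x : ℝ, 0 < x →
      ‖hankelOne ν x‖ ≤ C * (x ^ (-(1 / 2) : ℝ) * (1 + 1 / (2 * x)) ^ ν) := by
  set J := ∫ t in Set.Ioi (0 : ℝ), Real.exp (-t) * t ^ (ν - 1 / 2) * (2 ^ ν * (1 + t ^ ν)) with hJ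
  have hJ0 : 0 ≤ J := by
    refine setIntegral_nonneg measurableSet_Ioi fun t ht => ?_
    have ht : 0 < t := ht
    positivity
  have hG : 0 < Real.Gamma (ν + 1 / 2) := Real.Gamma_pos_of_pos (by linarith)
  refine ⟨Real.sqrt (2 / Real.pi) / Real.Gamma (ν + 1 / 2) * J, by positivity, fun x hx => ?_⟩
  have hI : ‖∫ t in Set.Ioi (0 : ℝ), ((Real.exp (-t) * t ^ (ν - 1 / 2) : ℝ) : ℂ) *
      (1 + Complex.I * ((t / (2 * x) : ℝ) : ℂ)) ^ ((ν - 1 / 2 : ℝ) : ℂ)‖ ≤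
      (1 + 1 / (2 * x)) ^ ν * J := by
    rw [hJ, ← integral_const_mul]
    refine norm_integral_le_of_norm_le ((integrableOn_hankel_majorant hν).const_mul _) ?_
    filter_upwards [ae_restrict_mem measurableSet_Ioi] with t ht
    exact norm_hankel_integrand_le hν hx ht
  have hs : Real.sqrt (2 / (Real.pi * x)) = Real.sqrt (2 / Real.pi) * x ^ (-(1 / 2) : ℝ) := by
    rw [← div_div, Real.sqrt_div' _ hx.le, Real.rpow_neg hx.le, ← Real.sqrt_eq_rpow,
      div_eq_mul_inv]
  have he : ‖Complex.exp (Complex.I * ((x - ν * Real.pi / 2 - Real.pi / 4 : ℝ) : ℂ))‖ = 1 := by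
    rw [mul_comm, Complex.norm_exp_ofReal_mul_I]
  rw [hankelOne, norm_mul, norm_div, norm_mul, he, Complex.norm_real, Complex.norm_real,
    Real.norm_of_nonneg (Real.sqrt_nonneg _), Real.norm_of_nonneg hG.le, hs, mul_one]
  calc _ ≤ Real.sqrt (2 / Real.pi) * x ^ (-(1 / 2) : ℝ) / Real.Gamma (ν + 1 / 2) *
        ((1 + 1 / (2 * x)) ^ ν * J) := by gcongr
    _ = _ := by ring

theorem measurable_radialSolution (n : ℕ) (k : Wavenumber) : Measurable (radialSolution n k) := by
  unfold radialSolution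
  have := (measurable_hankelOne (((n : ℝ) - 2) / 2)).comp (measurable_const_mul (k : ℝ))
  exact Measurable.mul (by fun_prop) this

theorem norm_radialSolution_le {n : ℕ} (hn : 2 ≤ n) (k : Wavenumber) {R : ℝ} (hR : 0 < R) :
    ∃ C : ℝ, ∀ r ∈ Set.Ioo 0 R, ‖radialSolution n k r‖ ≤ C * r ^ (3 / 2 - n : ℝ) := by
  have hk := k.2
  have hn' : (2 : ℝ) ≤ n := by exact_mod_cast hn
  set ν : ℝ := ((n : ℝ) - 2) / 2 with hνdef
  have hν : 0 ≤ ν := by rw [hνdef]; linarith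
  obtain ⟨C, hC, hH⟩ := norm_hankelOne_le hν
  refine ⟨1 / 4 * ((k : ℝ) / (2 * Real.pi)) ^ ν *
    (C * ((k : ℝ) ^ (-(1 / 2) : ℝ) * (R + 1 / (2 * k)) ^ ν)), fun r hr => ?_⟩
  have hr0 : 0 < r := hr.1
  have hrR : r ≤ R := hr.2.le
  have h1 : ((k : ℝ) / (2 * Real.pi * r)) ^ ν = ((k : ℝ) / (2 * Real.pi)) ^ ν * r ^ (-ν) := by
    rw [← div_div, Real.div_rpow (by positivity) hr0.le, Real.rpow_neg hr0.le, div_eq_mul_inv]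
  have h2 : (1 + 1 / (2 * (k * r))) ^ ν ≤ (R + 1 / (2 * k)) ^ ν * r ^ (-ν) := by
    rw [Real.rpow_neg hr0.le, ← div_eq_mul_inv, ← Real.div_rpow (by positivity) hr0.le]
    refine Real.rpow_le_rpow (by positivity) ?_ hν
    rw [le_div_iff₀ hr0]
    have : (1 + 1 / (2 * ((k : ℝ) * r))) * r = r + 1 / (2 * k) := by field_simp
    rw [this]
    linarith
  have h3 : r ^ (3 / 2 - n : ℝ) = r ^ (-ν) * (r ^ (-(1 / 2) : ℝ) * r ^ (-ν)) := by
    rw [← Real.rpow_add hr0, ← Real.rpow_add hr0]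
    congr 1
    rw [hνdef]
    ring
  have h4 : ‖(Complex.I / 4 : ℂ)‖ = 1 / 4 := by simp
  rw [radialSolution, norm_mul, norm_mul, h4, Complex.norm_real,
    Real.norm_of_nonneg (by positivity), h1]
  calc _ ≤ 1 / 4 * (((k : ℝ) / (2 * Real.pi)) ^ ν * r ^ (-ν)) *
        (C * (((k : ℝ) * r) ^ (-(1 / 2) : ℝ) * (1 + 1 / (2 * (k * r))) ^ ν)) := by
        gcongr
        exact hH _ (by positivity)
    _ ≤ 1 / 4 * (((k : ℝ) / (2 * Real.pi)) ^ ν * r ^ (-ν)) *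
        (C * (((k : ℝ) * r) ^ (-(1 / 2) : ℝ) * ((R + 1 / (2 * k)) ^ ν * r ^ (-ν)))) := by gcongr
    _ = _ := by
        rw [Real.mul_rpow hk.le hr0.le, h3]
        ring

theorem locallyIntegrable_radialSolution {n : ℕ} (hn : 2 ≤ n) (k : Wavenumber) :
    LocallyIntegrable (fun z : EuclideanSpace ℝ (Fin n) => radialSolution n k ‖z‖) := by
  have : Nonempty (Fin n) := ⟨⟨0, by omega⟩⟩
  rw [locallyIntegrable_iff]
  intro K hK
  obtain ⟨R, hR0, hR⟩ : ∃ R : ℝ, 0 < R ∧ K ⊆ Metric.ball 0 R := by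
    obtain ⟨R, hR⟩ := hK.isBounded.subset_ball 0
    exact ⟨max R 1, by positivity, hR.trans (Metric.ball_subset_ball (le_max_left _ _))⟩
  refine IntegrableOn.mono_set ?_ hR
  rw [integrableOn_fun_norm_addHaar]
  obtain ⟨C, hC⟩ := norm_radialSolution_le hn k hR0
  have hint : IntegrableOn (fun r : ℝ => C * r ^ (1 / 2 : ℝ)) (Set.Ioo 0 R) :=
    (((Real.continuous_rpow_const (by norm_num)).const_mul C).integrableOn_Icc
      (a := 0) (b := R)).mono_set Set.Ioo_subset_Icc_self
  refine Integrable.mono' hint ?_ ?_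
  · have := measurable_radialSolution n k
    exact Measurable.aestronglyMeasurable (by fun_prop)
  · filter_upwards [ae_restrict_mem measurableSet_Ioo] with r hr
    have hr0 : 0 < r := hr.1
    rw [norm_smul, Real.norm_of_nonneg (by positivity), finrank_euclideanSpace_fin]
    have e : r ^ (1 / 2 : ℝ) = r ^ (n - 1) * r ^ (3 / 2 - n : ℝ) := by
      rw [← Real.rpow_natCast, ← Real.rpow_add hr0, Nat.cast_sub (by omega)]
      congr 1
      push_cast
      ring
    rw [e]
    calc _ ≤ r ^ (n - 1) * (C * r ^ (3 / 2 - n : ℝ)) := by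
          gcongr
          exact hC r hr
      _ = _ := by ring

/-- The acoustic Newtonian potential `𝒜_k f(x) = ∫ Φ_k(x, y) f(y) dy` of a function `f`. -/
def newtonPotential (n : ℕ) (k : Wavenumber) (f : EuclideanSpace ℝ (Fin n) → ℂ)
    (x : EuclideanSpace ℝ (Fin n)) : ℂ :=
  ∫ y, fundamentalSolution n k x y * f y

theorem contDiff_newtonPotential {n : ℕ} (hn : 2 ≤ n) (k : Wavenumber)
    {f : EuclideanSpace ℝ (Fin n) → ℂ} (hf : ContDiff ℝ ∞ f) (hfc : HasCompactSupport f) :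
    ContDiff ℝ ∞ (newtonPotential n k f) := by
  have h := hfc.contDiff_convolution_right (ContinuousLinearMap.mul ℝ ℂ)
    (locallyIntegrable_radialSolution hn k) hf (n := ⊤)
  convert h using 1
  ext x
  rw [MeasureTheory.convolution_eq_swap]
  rfl

/-! ### The operator `A_{k,k}` and its norm -/

/-- `χ ∈ C_0^∞(ℝⁿ)` with `χ = 1` in a neighbourhood of `Γ`. -/
structure IsCutoff {n : ℕ} (Γ : Set (EuclideanSpace ℝ (Fin n)))
    (χ : EuclideanSpace ℝ (Fin n) → ℂ) : Prop where
  contDiff : ContDiff ℝ ∞ χ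
  hasCompactSupport : HasCompactSupport χ
  eventually_eq_one : ∀ᶠ x in 𝓝ˢ Γ, χ x = 1

/-- The test function `χ 𝒜_k(χφ)`. -/
def cutoffNewton {n : ℕ} (hn : 2 ≤ n) (k : Wavenumber) {Γ : Set (EuclideanSpace ℝ (Fin n))}
    {χ : EuclideanSpace ℝ (Fin n) → ℂ} (hχ : IsCutoff Γ χ)
    (φ : 𝓢(EuclideanSpace ℝ (Fin n), ℂ)) : 𝓢(EuclideanSpace ℝ (Fin n), ℂ) :=
  HasCompactSupport.toSchwartzMap
    (f := fun x => χ x * newtonPotential n k (fun y => χ y * φ y) x)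
    hχ.hasCompactSupport.mul_right
    (hχ.contDiff.mul (contDiff_newtonPotential hn k (hχ.contDiff.mul (φ.smooth ⊤))
      hχ.hasCompactSupport.mul_right))

/-- `v = χ 𝒜_k ψ` for a distribution `ψ` with support in `Γ`. The continuous extension of `𝒜_k` from
functions to compactly supported distributions is given by transposition, the kernel `Φ_k` being
symmetric: `(χ 𝒜_k ψ)(φ) = (𝒜_k ψ)(χφ) = ψ(𝒜_k(χφ)) = ψ(χ 𝒜_k(χφ))`, where the last equality holds
as `χ = 1` near `supp ψ` and gives a meaning to the value of `ψ` at the smooth function `𝒜_k(χφ)`. -/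
def IsCutoffPotential {n : ℕ} (hn : 2 ≤ n) (k : Wavenumber)
    {Γ : Set (EuclideanSpace ℝ (Fin n))} {χ : EuclideanSpace ℝ (Fin n) → ℂ} (hχ : IsCutoff Γ χ)
    (ψ v : 𝓢'(EuclideanSpace ℝ (Fin n), ℂ)) : Prop :=
  ∀ φ : 𝓢(EuclideanSpace ℝ (Fin n), ℂ), v φ = ψ (cutoffNewton hn k hχ φ)

open Classical in
/-- The operator `A_{k,k} ψ = P_k(χ 𝒜_k ψ)` from `H^{-1}_Γ` to `H̃^1(Γᶜ)^{⊥_k} ⊆ H^1(ℝⁿ)`.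
There is at most one `v` as below, and since `𝒜_k` maps compactly supported elements of `H^{-1}(ℝⁿ)`
to `H^{1,loc}(ℝⁿ)` there is always one: the value `0` of the second case is never taken. -/
def operatorA {n : ℕ} (hn : 2 ≤ n) (k : Wavenumber) {Γ : Set (EuclideanSpace ℝ (Fin n))}
    {χ : EuclideanSpace ℝ (Fin n) → ℂ} (hχ : IsCutoff Γ χ) (ψ : ↥(supportedIn n k (-1) Γ)) :
    ↥(tildeSpace n k 1 Γᶜ)ᗮ :=
  if h : ∃ v : SobolevSpace n k 1,
      IsCutoffPotential hn k hχ (SobolevSpace.toDistribution ψ.1) v.toDistribution then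
    projection n k Γ h.choose
  else 0

theorem IsCutoffPotential.unique {n : ℕ} {hn : 2 ≤ n} {k : Wavenumber}
    {Γ : Set (EuclideanSpace ℝ (Fin n))} {χ : EuclideanSpace ℝ (Fin n) → ℂ} {hχ : IsCutoff Γ χ}
    {ψ : 𝓢'(EuclideanSpace ℝ (Fin n), ℂ)} {v w : SobolevSpace n k 1}
    (hv : IsCutoffPotential hn k hχ ψ v.toDistribution)
    (hw : IsCutoffPotential hn k hχ ψ w.toDistribution) : v = w := by
  apply SobolevSpace.toDistribution_injective
  ext φ
  rw [hv φ, hw φ]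

/-- The operator norm `‖A_{k,k}‖_k`, the supremum of `‖A_{k,k} ψ‖_{H^1_k} / ‖ψ‖_{H^{-1}_k}` over the
non-zero `ψ ∈ H^{-1}_Γ`, as an element of `[0, ∞]`. -/
def operatorNormA {n : ℕ} (hn : 2 ≤ n) (k : Wavenumber) {Γ : Set (EuclideanSpace ℝ (Fin n))}
    {χ : EuclideanSpace ℝ (Fin n) → ℂ} (hχ : IsCutoff Γ χ) : ℝ≥0∞ :=
  ⨆ (ψ : ↥(supportedIn n k (-1) Γ)) (_ : (ψ : SobolevSpace n k (-1)) ≠ 0),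
    ‖operatorA hn k hχ ψ‖ₑ / ‖(ψ : SobolevSpace n k (-1))‖ₑ

end Helmholtz

end

noncomputable section

namespace Helmholtz

open scoped LineDeriv Laplacian

/-! One explicit source already gives the lower bound. Fix a nonzero test function `g` supported in
the interior of `Γ` and a unit vector `d`. Put `f(x) = e^{ik⟨d,x⟩} g(x)` and `h = -(Δ + k²) f`. The
plane wave solves the Helmholtz equation, so the `k²` terms cancel and `h = -e^{ik⟨d,x⟩}(Δg + 2ik
∂_d g)` has size only `O(k)` in `L²` (`helmholtz_modulate`).

Since `Φ_k` is a fundamental solution of `-(Δ + k²)`, the potential of `h` is `f` itself, and the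
cutoff changes nothing because `f` lives in `Γ` (`isCutoffPotential_of_helmholtz`). The inner
product of `H^1_k` pairs `φ` with `(k² - Δ) f`, a local expression, so `f` is orthogonal to
everything supported off `Γ` and `P_k f = f` (`mem_orthogonal_tildeSpace`). Thus `A_{k,k} h = f`.
The weights give `‖f‖_{H^1_k} ≥ k‖g‖` and `‖h‖_{H^{-1}_k} ≤ k⁻¹(‖Δg‖ + 2k‖∂_d g‖)`, with `L²` norms
on the right, so the quotient is at least of order `k` for `k ≥ k₀`.

Most of the work is to derive the fundamental solution property from Hankel's integral. After a
substitution the radial profile `G` is a multiple of the Laplace integral `∫ e^{-r(p - ik)} p^a (1 +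
ip/(2k))^a dp` over `p > 0`, with `a = (n-3)/2`. Differentiation in `r` produces moments;
integration by parts in `p` gives the radial Helmholtz equation (`laplaceMoment_equation`), and
dominated convergence gives the limit of `r^{n-1} G'(r)` at the origin (`tendsto_laplaceMoment_one`,
`laplaceConst_mul`). The singularity is then handled by replacing `|x - a|` with `ρ = √(|x - a|² +
δ²)`: the Helmholtz operator applied to `G(ρ)` is a rescaled bump of asymptotic mass `-1`, and `δ →
0` yields `integral_radialSolution_mul_helmholtz`. -/

/-! ### The radial profile as a Laplace transform -/

/-- The density `p^a (1 + ip/(2k))^a`. -/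
def laplaceDensity (a k p : ℝ) : ℂ :=
  ((p ^ a : ℝ) : ℂ) * (1 + Complex.I * ((p / (2 * k) : ℝ) : ℂ)) ^ (a : ℂ)

/-- The frequency `p - ik`. -/
def laplaceFrequency (k p : ℝ) : ℂ := (p : ℂ) - Complex.I * (k : ℂ)

/-- The integrand of the `j`-th moment of the Laplace transform. -/
def laplaceIntegrand (a k : ℝ) (j : ℕ) (r p : ℝ) : ℂ :=
  laplaceFrequency k p ^ j * Complex.exp (-(r : ℂ) * laplaceFrequency k p) * laplaceDensity a k p

/-- The `j`-th moment of the Laplace transform. -/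
def laplaceMoment (a k : ℝ) (j : ℕ) (r : ℝ) : ℂ :=
  ∫ p in Set.Ioi (0 : ℝ), laplaceIntegrand a k j r p

theorem measurable_laplaceIntegrand (a k : ℝ) (j : ℕ) (r : ℝ) :
    Measurable (laplaceIntegrand a k j r) := by
  unfold laplaceIntegrand laplaceFrequency laplaceDensity
  fun_prop

theorem norm_one_add_I_mul_le {q : ℝ} (hq : 0 ≤ q) : ‖1 + Complex.I * (q : ℂ)‖ ≤ 1 + q := by
  refine (norm_add_le _ _).trans ?_
  rw [norm_one, norm_mul, Complex.norm_I, one_mul, Complex.norm_real, Real.norm_of_nonneg hq]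

theorem one_le_norm_one_add_I_mul (q : ℝ) : 1 ≤ ‖1 + Complex.I * (q : ℂ)‖ := by
  have := Complex.abs_re_le_norm (1 + Complex.I * (q : ℂ))
  rwa [Complex.add_re, Complex.one_re, Complex.I_mul_re, Complex.ofReal_im, neg_zero, add_zero,
    abs_one] at this

/-- Apply `x ≤ e^x` to `x = δ(1 + p)/b` and raise to the power `b`. Polynomial growth is thereby
absorbed by an exponential of arbitrarily small rate. -/
theorem one_add_rpow_le_exp {b δ : ℝ} (hb : 0 < b) (hδ : 0 < δ) {p : ℝ} (hp : 0 ≤ p) :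
    (1 + p) ^ b ≤ (b / δ) ^ b * Real.exp δ * Real.exp (δ * p) := by
  have h1 : (1 + p) = (b / δ) * (δ / b * (1 + p)) := by field_simp
  have h2 : δ / b * (1 + p) ≤ Real.exp (δ / b * (1 + p)) := by
    have := Real.add_one_le_exp (δ / b * (1 + p))
    linarith
  rw [h1, Real.mul_rpow (by positivity) (by positivity), mul_assoc]
  gcongr
  · calc (δ / b * (1 + p)) ^ b ≤ (Real.exp (δ / b * (1 + p))) ^ b := by gcongr
      _ = Real.exp δ * Real.exp (δ * p) := by
        rw [← Real.exp_mul, ← Real.exp_add]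
        congr 1
        field_simp

theorem norm_laplaceFrequency_le {k p : ℝ} (hk : 0 < k) (hp : 0 ≤ p) :
    ‖laplaceFrequency k p‖ ≤ p + k := by
  refine (norm_sub_le _ _).trans ?_
  rw [norm_mul, Complex.norm_I, one_mul, Complex.norm_real, Complex.norm_real,
    Real.norm_of_nonneg hp, Real.norm_of_nonneg hk.le]

/-- The complex base has modulus at least 1, so the exponent `a`, which is negative when `n = 2`,
may be replaced by `|a|`. -/
theorem norm_laplaceDensity_le (a : ℝ) {k p : ℝ} (hk : 0 < k) (hp : 0 < p) :
    ‖laplaceDensity a k p‖ ≤ p ^ a * (1 + p / (2 * k)) ^ |a| := by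
  rw [laplaceDensity, norm_mul, Complex.norm_real, Real.norm_of_nonneg (by positivity),
    Complex.norm_cpow_real]
  gcongr
  calc _ ≤ ‖1 + Complex.I * ((p / (2 * k) : ℝ) : ℂ)‖ ^ |a| :=
        Real.rpow_le_rpow_of_exponent_le (one_le_norm_one_add_I_mul _) (le_abs_self a)
    _ ≤ _ := by
        gcongr
        exact norm_one_add_I_mul_le (by positivity)

/-- The moments are dominated by the Gamma integrand. -/
theorem exists_norm_laplaceIntegrand_le (a : ℝ) {k : ℝ} (hk : 0 < k) (j : ℕ) {δ : ℝ} (hδ : 0 < δ) :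
    ∃ C : ℝ, 0 ≤ C ∧ ∀ r p : ℝ, 0 < p →
      ‖laplaceIntegrand a k j r p‖ ≤ C * (p ^ a * Real.exp (-(r - δ) * p)) := by
  -- `M` dominates both `p + k` and `1 + p/(2k)` by `M(1 + p)`; the extra 1 in `b` makes that
  -- exponent positive.
  set M : ℝ := 1 + k + 1 / (2 * k)
  set b : ℝ := |a| + j + 1
  have hM : 1 ≤ M := by
    have : 0 < 1 / (2 * k) := by positivity
    simp only [M]; linarith
  have hb : 0 < b := by positivity
  refine ⟨M ^ b * ((b / δ) ^ b * Real.exp δ), by positivity, fun r p hp => ?_⟩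
  have h1 : 1 + p / (2 * k) ≤ M * (1 + p) := by
    have : p / (2 * k) = 1 / (2 * k) * p := by ring
    have h0 : 0 < 1 / (2 * k) := by positivity
    simp only [M]
    nlinarith [mul_pos h0 hp, mul_pos hk hp]
  have h2 : p + k ≤ M * (1 + p) := by
    have h0 : 0 < 1 / (2 * k) := by positivity
    simp only [M]
    nlinarith [mul_pos h0 hp, mul_pos hk hp]
  have h3 : (1 : ℝ) ≤ M * (1 + p) := by nlinarith
  have h4 : (p + k) ^ j * (1 + p / (2 * k)) ^ |a| ≤
      M ^ b * ((b / δ) ^ b * Real.exp δ) * Real.exp (δ * p) := by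
    calc (p + k) ^ j * (1 + p / (2 * k)) ^ |a| ≤
          (M * (1 + p)) ^ j * (M * (1 + p)) ^ |a| := by gcongr
      _ = (M * (1 + p)) ^ (j + |a|) := by
          rw [← Real.rpow_natCast, ← Real.rpow_add (by positivity)]
      _ ≤ (M * (1 + p)) ^ b := by
          refine Real.rpow_le_rpow_of_exponent_le h3 ?_
          simp only [b]; linarith
      _ = M ^ b * (1 + p) ^ b := Real.mul_rpow (by positivity) (by positivity)
      _ ≤ M ^ b * ((b / δ) ^ b * Real.exp δ * Real.exp (δ * p)) := by
          gcongr
          exact one_add_rpow_le_exp hb hδ hp.le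
      _ = _ := by ring
  have h5 : ‖Complex.exp (-(r : ℂ) * laplaceFrequency k p)‖ = Real.exp (-r * p) := by
    rw [Complex.norm_exp]
    simp [laplaceFrequency]
  rw [laplaceIntegrand, norm_mul, norm_mul, h5, norm_pow]
  calc _ ≤ (p + k) ^ j * Real.exp (-r * p) * (p ^ a * (1 + p / (2 * k)) ^ |a|) := by
        gcongr
        · exact norm_laplaceFrequency_le hk hp.le
        · exact norm_laplaceDensity_le a hk hp
    _ = (p + k) ^ j * (1 + p / (2 * k)) ^ |a| * (p ^ a * Real.exp (-r * p)) := by ring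
    _ ≤ M ^ b * ((b / δ) ^ b * Real.exp δ) * Real.exp (δ * p) * (p ^ a * Real.exp (-r * p)) := by
        gcongr
    _ = _ := by
        have : -(r - δ) * p = δ * p + -r * p := by ring
        rw [this, Real.exp_add]
        ring

theorem integrableOn_rpow_mul_exp {a b : ℝ} (ha : -1 < a) (hb : 0 < b) :
    IntegrableOn (fun p : ℝ => p ^ a * Real.exp (-b * p)) (Set.Ioi 0) := by
  simpa using integrableOn_rpow_mul_exp_neg_mul_rpow (p := 1) ha one_pos hb

theorem integrableOn_laplaceIntegrand {a k : ℝ} (ha : -1 < a) (hk : 0 < k) (j : ℕ) {r : ℝ}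
    (hr : 0 < r) : IntegrableOn (laplaceIntegrand a k j r) (Set.Ioi 0) := by
  obtain ⟨C, -, hC⟩ := exists_norm_laplaceIntegrand_le a hk j (half_pos hr)
  have := (integrableOn_rpow_mul_exp (b := r - r / 2) ha (by linarith)).const_mul C
  refine Integrable.mono' this (measurable_laplaceIntegrand a k j r).aestronglyMeasurable ?_
  filter_upwards [ae_restrict_mem measurableSet_Ioi] with p hp
  exact hC r p hp

theorem hasDerivAt_laplaceMoment {a k : ℝ} (ha : -1 < a) (hk : 0 < k) (j : ℕ) {r : ℝ}
    (hr : 0 < r) : HasDerivAt (laplaceMoment a k j) (-laplaceMoment a k (j + 1) r) r := by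
  -- For `s > r/2`, giving up `r/4` still leaves the decay rate `s - r/4 > r/4`, uniformly near `r`.
  obtain ⟨C, hC0, hC⟩ := exists_norm_laplaceIntegrand_le a hk (j + 1) (δ := r / 4) (by linarith)
  have hb := (integrableOn_rpow_mul_exp (a := a) (b := r / 4) ha (by linarith)).const_mul C
  have := (hasDerivAt_integral_of_dominated_loc_of_deriv_le
    (F := laplaceIntegrand a k j) (F' := fun s p => -laplaceIntegrand a k (j + 1) s p)
    (μ := volume.restrict (Set.Ioi 0)) (s := Set.Ioi (r / 2)) (x₀ := r)
    (bound := fun p => C * (p ^ a * Real.exp (-(r / 4) * p)))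
    (Ioi_mem_nhds (by linarith))
    (Eventually.of_forall fun s => (measurable_laplaceIntegrand a k j s).aestronglyMeasurable)
    (integrableOn_laplaceIntegrand ha hk j hr)
    (measurable_laplaceIntegrand a k (j + 1) r).neg.aestronglyMeasurable
    ?_ hb ?_).2
  · rw [integral_neg] at this
    exact this
  · filter_upwards [ae_restrict_mem measurableSet_Ioi] with p hp s hs
    have hp : 0 < p := hp
    have hs : r / 2 < s := hs
    rw [norm_neg]
    refine (hC s p hp).trans ?_
    gcongr
    linarith
  · refine Eventually.of_forall fun p s _ => ?_
    have h1 : HasDerivAt (fun s : ℝ => -(s : ℂ) * laplaceFrequency k p)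
        (-1 * laplaceFrequency k p) s :=
      (Complex.ofRealCLM.hasDerivAt (x := s)).neg.mul_const _
    have h2 := (h1.cexp.const_mul (laplaceFrequency k p ^ j)).mul_const (laplaceDensity a k p)
    have h3 : HasDerivAt (fun s => laplaceIntegrand a k j s p) _ s := h2
    refine h3.congr_deriv ?_
    simp only [laplaceIntegrand]
    ring

theorem one_add_I_mul_mem_slitPlane (q : ℝ) : 1 + Complex.I * (q : ℂ) ∈ Complex.slitPlane := by
  left
  simp

/-- The density behaves as a power of `p(1 + ip/(2k))`, whose derivative `1 + ip/k` equals `(i/k)(p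
- ik)`. -/
theorem hasDerivAt_laplaceDensity (a : ℝ) {k p : ℝ} (hk : 0 < k) (hp : 0 < p) :
    HasDerivAt (laplaceDensity (a + 1) k)
      ((a + 1) * (Complex.I / k) * laplaceFrequency k p * laplaceDensity a k p) p := by
  have h1 : HasDerivAt (fun p : ℝ => ((p ^ (a + 1) : ℝ) : ℂ)) (((a + 1) * p ^ a : ℝ) : ℂ) p := by
    have := (Real.hasDerivAt_rpow_const (x := p) (p := a + 1) (Or.inl hp.ne')).ofReal_comp
    simpa using this
  have h2 : HasDerivAt (fun p : ℝ => 1 + Complex.I * ((p / (2 * k) : ℝ) : ℂ))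
      (Complex.I * ((1 / (2 * k) : ℝ) : ℂ)) p :=
    ((((hasDerivAt_id p).div_const (2 * k)).ofReal_comp).const_mul Complex.I).const_add 1
  have h3 := ((hasDerivAt_id _).cpow_const (c := ((a + 1 : ℝ) : ℂ))
    (one_add_I_mul_mem_slitPlane (p / (2 * k)))).comp p h2
  have h4 : HasDerivAt (laplaceDensity (a + 1) k) _ p := h1.mul h3
  have hk' : (k : ℂ) ≠ 0 := by exact_mod_cast hk.ne'
  have hne : (1 + Complex.I * ((p / (2 * k) : ℝ) : ℂ)) ≠ 0 :=
    Complex.slitPlane_ne_zero (one_add_I_mul_mem_slitPlane _)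
  refine h4.congr_deriv ?_
  simp only [id_eq, mul_one]
  have e1 : ((p ^ (a + 1) : ℝ) : ℂ) = ((p ^ a : ℝ) : ℂ) * p := by
    rw [Real.rpow_add_one hp.ne']; push_cast; ring
  have e2 : (1 + Complex.I * ((p / (2 * k) : ℝ) : ℂ)) ^ (((a + 1 : ℝ)) : ℂ) =
      (1 + Complex.I * ((p / (2 * k) : ℝ) : ℂ)) ^ (a : ℂ) *
        (1 + Complex.I * ((p / (2 * k) : ℝ) : ℂ)) := by
    rw [Complex.ofReal_add, Complex.ofReal_one, Complex.cpow_add _ _ hne, Complex.cpow_one]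
  have e3 : (((a + 1 : ℝ) : ℂ) - 1) = a := by push_cast; ring
  rw [e1, e2, e3, laplaceFrequency, laplaceDensity]
  push_cast
  field_simp
  ring_nf
  rw [Complex.I_sq]
  ring

/-- The factorisation `(p - ik)² + k² = -2ik · p(1 + ip/(2k))` raises the exponent of the density by
one. This is what makes integration by parts possible. -/
theorem laplaceFrequency_sq_add {k p : ℝ} (hk : 0 < k) (hp : 0 < p) (a : ℝ) :
    (laplaceFrequency k p ^ 2 + k ^ 2) * laplaceDensity a k p =
      -2 * Complex.I * k * laplaceDensity (a + 1) k p := by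
  have hk' : (k : ℂ) ≠ 0 := by exact_mod_cast hk.ne'
  have hne : (1 + Complex.I * ((p / (2 * k) : ℝ) : ℂ)) ≠ 0 :=
    Complex.slitPlane_ne_zero (one_add_I_mul_mem_slitPlane _)
  rw [laplaceDensity, laplaceDensity, Real.rpow_add_one hp.ne', Complex.ofReal_add,
    Complex.ofReal_one, Complex.cpow_add _ _ hne, Complex.cpow_one, laplaceFrequency]
  push_cast
  field_simp
  ring_nf
  simp only [Complex.I_sq]
  ring

theorem norm_laplaceDensity_add_one_le {a k p : ℝ} (ha : -1 < a) (hk : 0 < k) (hp : 0 < p) :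
    ‖laplaceDensity (a + 1) k p‖ ≤ (p * (1 + p / (2 * k))) ^ (a + 1) := by
  refine (norm_laplaceDensity_le (a + 1) hk hp).trans ?_
  rw [abs_of_pos (by linarith), Real.mul_rpow hp.le (by positivity)]

theorem tendsto_laplaceDensity_zero {a k : ℝ} (ha : -1 < a) (hk : 0 < k) :
    Tendsto (laplaceDensity (a + 1) k) (𝓝[>] 0) (𝓝 0) := by
  have h1 : Continuous (fun p : ℝ => (p * (1 + p / (2 * k))) ^ (a + 1)) :=
    Continuous.rpow_const (by fun_prop) (fun _ => Or.inr (by linarith))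
  have h2 : Tendsto (fun p : ℝ => (p * (1 + p / (2 * k))) ^ (a + 1)) (𝓝[>] 0) (𝓝 0) := by
    have := h1.tendsto 0
    rw [zero_mul, Real.zero_rpow (by linarith)] at this
    exact this.mono_left nhdsWithin_le_nhds
  refine squeeze_zero_norm' ?_ h2
  filter_upwards [self_mem_nhdsWithin] with p hp
  exact norm_laplaceDensity_add_one_le ha hk hp

/-- Integration by parts in the Laplace integral gives Bessel's equation. -/
theorem laplaceMoment_equation {a k : ℝ} (ha : -1 < a) (hk : 0 < k) {r : ℝ} (hr : 0 < r) :
    (r : ℂ) * (laplaceMoment a k 2 r + k ^ 2 * laplaceMoment a k 0 r) -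
      2 * (a + 1) * laplaceMoment a k 1 r = 0 := by
  -- `f` is an explicit primitive in `p` of the integrand `f'` of the claimed identity. It vanishes
  -- at both ends, so the integral of `f'` is zero.
  set f : ℝ → ℂ := fun p => 2 * Complex.I * k * laplaceIntegrand (a + 1) k 0 r p with hf
  set f' : ℝ → ℂ := fun p => (r : ℂ) * (laplaceIntegrand a k 2 r p +
    k ^ 2 * laplaceIntegrand a k 0 r p) - 2 * (a + 1) * laplaceIntegrand a k 1 r p with hf'
  have i0 := integrableOn_laplaceIntegrand ha hk 0 hr
  have i1 := integrableOn_laplaceIntegrand ha hk 1 hr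
  have i2 := integrableOn_laplaceIntegrand ha hk 2 hr
  have hint : IntegrableOn f' (Set.Ioi 0) :=
    ((i2.add (i0.const_mul _)).const_mul _).sub (i1.const_mul _)
  have hderiv : ∀ p ∈ Set.Ioi (0 : ℝ), HasDerivAt f (f' p) p := by
    intro p hp
    have hp : 0 < p := hp
    have hk' : (k : ℂ) ≠ 0 := by exact_mod_cast hk.ne'
    have h1 : HasDerivAt (fun p : ℝ => -(r : ℂ) * laplaceFrequency k p) (-(r : ℂ) * 1) p :=
      ((Complex.ofRealCLM.hasDerivAt (x := p)).sub_const _).const_mul _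
    have h2 := (h1.cexp.mul (hasDerivAt_laplaceDensity a hk hp)).const_mul (2 * Complex.I * k)
    have h3 := laplaceFrequency_sq_add hk hp a
    have h4 : HasDerivAt f _ p := h2.congr_of_eventuallyEq
      (Eventually.of_forall fun q => by simp [hf, laplaceIntegrand])
    refine h4.congr_deriv ?_
    simp only [hf', laplaceIntegrand]
    have : 2 * Complex.I * (k : ℂ) * (Complex.I / k) = -2 := by
      field_simp
      rw [Complex.I_sq]
    linear_combination -(r : ℂ) * Complex.exp (-(r : ℂ) * laplaceFrequency k p) * h3 +
      (a + 1) * Complex.exp (-(r : ℂ) * laplaceFrequency k p) * laplaceFrequency k p *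
        laplaceDensity a k p * this
  have hzero : Tendsto f (𝓝[>] 0) (𝓝 0) := by
    have h1 : Continuous (fun p : ℝ => Complex.exp (-(r : ℂ) * laplaceFrequency k p)) := by
      unfold laplaceFrequency; fun_prop
    have h2 := ((h1.tendsto 0).mono_left nhdsWithin_le_nhds).mul
      (tendsto_laplaceDensity_zero ha hk)
    rw [mul_zero] at h2
    have h3 := h2.const_mul (2 * Complex.I * k)
    rw [mul_zero] at h3
    refine h3.congr fun p => ?_
    simp [hf, laplaceIntegrand]
  have hinf : Tendsto f atTop (𝓝 0) := by
    obtain ⟨C, -, hC⟩ := exists_norm_laplaceIntegrand_le (a + 1) hk 0 (half_pos hr)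
    have h1 : Tendsto (fun p : ℝ => C * (p ^ (a + 1) * Real.exp (-(r - r / 2) * p))) atTop
        (𝓝 0) := by
      have := (tendsto_rpow_mul_exp_neg_mul_atTop_nhds_zero (a + 1) (r - r / 2)
        (by linarith)).const_mul C
      rwa [mul_zero] at this
    have h2 : Tendsto (laplaceIntegrand (a + 1) k 0 r) atTop (𝓝 0) := by
      refine squeeze_zero_norm' ?_ h1
      filter_upwards [eventually_gt_atTop 0] with p hp
      exact hC r p hp
    have := h2.const_mul (2 * Complex.I * k)
    rwa [mul_zero] at this
  -- Overwriting the value at 0 by the limit turns continuity at the endpoint into `hzero`.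
  have := integral_Ioi_of_hasDerivAt_of_tendsto (f := Function.update f 0 0) (f' := f')
    (a := 0) (m := 0) ?_ ?_ hint ?_
  · simp only [Function.update_self, sub_zero] at this
    rw [← this]
    have e1 : ∫ p in Set.Ioi 0, f' p = _ :=
      integral_sub ((i2.add (i0.const_mul ((k : ℂ) ^ 2))).const_mul (r : ℂ))
        (i1.const_mul (2 * ((a : ℂ) + 1)))
    have e2 := integral_add i2 (i0.const_mul ((k : ℂ) ^ 2))
    rw [e1, integral_const_mul, integral_const_mul, e2, integral_const_mul]
    rfl
  · rw [continuousWithinAt_update_same]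
    simpa using hzero
  · intro p hp
    refine (hderiv p hp).congr_of_eventuallyEq ?_
    filter_upwards [lt_mem_nhds hp] with q hq
    rw [Function.update_of_ne hq.ne']
  · refine hinf.congr' ?_
    filter_upwards [eventually_gt_atTop 0] with q hq
    rw [Function.update_of_ne hq.ne']

/-! ### The radial profile as a Laplace moment, and its singularity at the origin -/

theorem ofReal_mul_cpow {r : ℝ} (hr : 0 < r) {z : ℂ} (hz : z ≠ 0) (a : ℝ) :
    ((r : ℂ) * z) ^ (a : ℂ) = ((r ^ a : ℝ) : ℂ) * z ^ (a : ℂ) := by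
  have hr' : (r : ℂ) ≠ 0 := by exact_mod_cast hr.ne'
  rw [Complex.cpow_def_of_ne_zero (mul_ne_zero hr' hz), Complex.log_ofReal_mul hr hz, add_mul,
    Complex.exp_add, ← Complex.cpow_def_of_ne_zero hz, Complex.ofReal_log hr.le,
    ← Complex.cpow_def_of_ne_zero hr', Complex.ofReal_cpow hr.le]

/-- The constant that relates the radial profile to the Laplace transform. -/
def laplaceConst (a k : ℝ) : ℂ :=
  Complex.I / 4 * (((k / (2 * Real.pi)) ^ (a + 1 / 2) * Real.sqrt (2 / (Real.pi * k)) /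
    Real.Gamma (a + 1) : ℝ) : ℂ) *
    Complex.exp (-(Complex.I * (((a + 1) * (Real.pi / 2) : ℝ) : ℂ)))

/-- Substitute `t = rp` in Hankel's integral, with `a = ν - 1/2`. The oscillating factor `e^{ikr}`
merges with `e^{-rp}` into the complex frequency `p - ik`. -/
theorem radialSolution_eq (n : ℕ) (k : Wavenumber) {r : ℝ} (hr : 0 < r) :
    radialSolution n k r =
      laplaceConst (((n : ℝ) - 3) / 2) k * laplaceMoment (((n : ℝ) - 3) / 2) k 0 r := by
  have hk := k.2
  set a : ℝ := ((n : ℝ) - 3) / 2 with ha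
  have e1 : ((n : ℝ) - 2) / 2 = a + 1 / 2 := by rw [ha]; ring
  have e2 : a + 1 / 2 - 1 / 2 = a := by ring
  have e3 : a + 1 / 2 + 1 / 2 = a + 1 := by ring
  rw [radialSolution, hankelOne, e1, e2, e3]
  have hsub : ∫ t in Set.Ioi (0 : ℝ), ((Real.exp (-t) * t ^ a : ℝ) : ℂ) *
      (1 + Complex.I * ((t / (2 * ((k : ℝ) * r)) : ℝ) : ℂ)) ^ (a : ℂ) =
      ((r ^ (a + 1) : ℝ) : ℂ) * Complex.exp (-(Complex.I * ((k : ℝ) * r : ℝ))) *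
        laplaceMoment a k 0 r := by
    have h := integral_comp_mul_left_Ioi (fun t : ℝ => ((Real.exp (-t) * t ^ a : ℝ) : ℂ) *
      (1 + Complex.I * ((t / (2 * ((k : ℝ) * r)) : ℝ) : ℂ)) ^ (a : ℂ)) 0 hr
    rw [mul_zero, eq_inv_smul_iff₀ hr.ne'] at h
    rw [← h, laplaceMoment, ← integral_const_mul, Complex.real_smul, ← integral_const_mul]
    refine setIntegral_congr_fun measurableSet_Ioi fun p hp => ?_
    have hp : 0 < p := hp
    have e4 : r * p / (2 * ((k : ℝ) * r)) = p / (2 * k) := by field_simp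
    have e5 : Complex.exp (-(r : ℂ) * laplaceFrequency k p) =
        Complex.exp (Complex.I * ((k : ℝ) * r : ℝ)) * ((Real.exp (-(r * p)) : ℝ) : ℂ) := by
      rw [Complex.ofReal_exp, ← Complex.exp_add, laplaceFrequency]
      congr 1
      push_cast
      ring
    have e6 : Complex.exp (-(Complex.I * ((k : ℝ) * r : ℝ))) *
        Complex.exp (Complex.I * ((k : ℝ) * r : ℝ)) = 1 := by
      rw [← Complex.exp_add, neg_add_cancel, Complex.exp_zero]
    simp only [laplaceIntegrand, laplaceDensity, e4, e5, pow_zero, one_mul]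
    rw [Real.mul_rpow hr.le hp.le, Real.rpow_add_one hr.ne']
    simp only [Complex.ofReal_mul] at e6 ⊢
    linear_combination -((r : ℂ) * ((Real.exp (-(r * p)) : ℝ) : ℂ) * ((r ^ a : ℝ) : ℂ) *
      ((p ^ a : ℝ) : ℂ) * (1 + Complex.I * ((p / (2 * k) : ℝ) : ℂ)) ^ (a : ℂ)) * e6
  rw [hsub, laplaceConst]
  have e7 : ((k : ℝ) / (2 * Real.pi * r)) ^ (a + 1 / 2) =
      ((k : ℝ) / (2 * Real.pi)) ^ (a + 1 / 2) * r ^ (-(a + 1 / 2)) := by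
    rw [← div_div, Real.div_rpow (by positivity) hr.le, Real.rpow_neg hr.le, div_eq_mul_inv]
  have e8 : Real.sqrt (2 / (Real.pi * ((k : ℝ) * r))) =
      Real.sqrt (2 / (Real.pi * k)) * r ^ (-(1 / 2) : ℝ) := by
    rw [← mul_assoc, ← div_div, Real.sqrt_div' _ hr.le, Real.rpow_neg hr.le,
      ← Real.sqrt_eq_rpow, div_eq_mul_inv]
  -- The powers of `r` come from the prefactor of `Φ_k`, from the square root in the Hankel function
  -- and from the substitution; they cancel exactly.
  have e9 : r ^ (-(a + 1 / 2)) * r ^ (-(1 / 2) : ℝ) * r ^ (a + 1) = 1 := by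
    rw [← Real.rpow_add hr, ← Real.rpow_add hr]
    ring_nf
    exact Real.rpow_zero r
  have e9' := congrArg (fun x : ℝ => (x : ℂ)) e9
  have e10 : Complex.exp (Complex.I *
      (((k : ℝ) * r - (a + 1 / 2) * Real.pi / 2 - Real.pi / 4 : ℝ) : ℂ)) *
      Complex.exp (-(Complex.I * ((k : ℝ) * r : ℝ))) =
      Complex.exp (-(Complex.I * (((a + 1) * (Real.pi / 2) : ℝ) : ℂ))) := by
    rw [← Complex.exp_add]
    congr 1
    push_cast
    ring
  rw [e7, e8, ← e10]
  simp only [Complex.ofReal_mul, Complex.ofReal_div, Complex.ofReal_one] at e9' ⊢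
  linear_combination (Complex.I / 4 * (((k : ℝ) / (2 * Real.pi)) ^ (a + 1 / 2) : ℝ) *
    (Real.sqrt (2 / (Real.pi * k)) : ℂ) / (Real.Gamma (a + 1) : ℂ) * Complex.exp (Complex.I *
      (((k : ℝ) * r - (a + 1 / 2) * Real.pi / 2 - Real.pi / 4 : ℝ) : ℂ)) *
      Complex.exp (-(Complex.I * ((k : ℂ) * r))) * laplaceMoment a k 0 r) * e9'

/-- The first moment after the substitution `t = rp`. -/
theorem rpow_mul_laplaceMoment_one (a k : ℝ) {r : ℝ} (hr : 0 < r) :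
    ((r ^ (2 * a + 2) : ℝ) : ℂ) * laplaceMoment a k 1 r =
      Complex.exp (Complex.I * (k * r)) * ∫ t in Set.Ioi (0 : ℝ),
        ((t : ℂ) - Complex.I * (k * r)) * ((Real.exp (-t) * t ^ a : ℝ) : ℂ) *
          ((r : ℂ) + Complex.I * ((t / (2 * k) : ℝ) : ℂ)) ^ (a : ℂ) := by
  have h := integral_comp_mul_left_Ioi (fun t : ℝ =>
    ((t : ℂ) - Complex.I * (k * r)) * ((Real.exp (-t) * t ^ a : ℝ) : ℂ) *
          ((r : ℂ) + Complex.I * ((t / (2 * k) : ℝ) : ℂ)) ^ (a : ℂ)) 0 hr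
  rw [mul_zero, eq_inv_smul_iff₀ hr.ne'] at h
  rw [← h, laplaceMoment, ← integral_const_mul, Complex.real_smul, ← integral_const_mul,
    ← integral_const_mul]
  refine setIntegral_congr_fun measurableSet_Ioi fun p hp => ?_
  have hp : 0 < p := hp
  have e1 : (r : ℂ) + Complex.I * ((r * p / (2 * k) : ℝ) : ℂ) =
      (r : ℂ) * (1 + Complex.I * ((p / (2 * k) : ℝ) : ℂ)) := by push_cast; ring
  have e2 : Complex.exp (-(r : ℂ) * laplaceFrequency k p) =
      Complex.exp (Complex.I * (k * r)) * ((Real.exp (-(r * p)) : ℝ) : ℂ) := by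
    rw [Complex.ofReal_exp, ← Complex.exp_add, laplaceFrequency]
    congr 1
    push_cast
    ring
  have e3 : r ^ (2 * a + 2) = r ^ a * r ^ a * r * r := by
    rw [← Real.rpow_add hr, ← Real.rpow_add_one hr.ne', ← Real.rpow_add_one hr.ne']
    ring_nf
  simp only [e1, laplaceIntegrand, laplaceDensity, e2, e3]
  rw [ofReal_mul_cpow hr (Complex.slitPlane_ne_zero (one_add_I_mul_mem_slitPlane _)),
    Real.mul_rpow hr.le hp.le, laplaceFrequency]
  push_cast
  ring

/-- In the rescaled integral one may put `r = 0`: the integrand becomes `(i/(2k))^a e^{-t}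
t^{2a+1}`, a Gamma integral. -/
theorem tendsto_laplaceMoment_one {a k : ℝ} (ha : -1 < a) (hk : 0 < k) :
    Tendsto (fun r : ℝ => ((r ^ (2 * a + 2) : ℝ) : ℂ) * laplaceMoment a k 1 r) (𝓝[>] 0)
      (𝓝 (((1 / (2 * k)) ^ a * Real.Gamma (2 * a + 2) : ℝ) * Complex.I ^ (a : ℂ))) := by
  set F : ℝ → ℝ → ℂ := fun r t =>
    ((t : ℂ) - Complex.I * (k * r)) * ((Real.exp (-t) * t ^ a : ℝ) : ℂ) *
          ((r : ℂ) + Complex.I * ((t / (2 * k) : ℝ) : ℂ)) ^ (a : ℂ) with hF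
  set F₀ : ℝ → ℂ := fun t => (((1 / (2 * k)) ^ a : ℝ) : ℂ) * Complex.I ^ (a : ℂ) *
    ((Real.exp (-t) * t ^ (2 * a + 2 - 1) : ℝ) : ℂ) with hF₀
  set M : ℝ := 1 + 1 / (2 * k) with hM
  have hMpos : 0 < M := by positivity
  have hlim : Tendsto (fun r => ∫ t in Set.Ioi (0 : ℝ), F r t) (𝓝[>] 0)
      (𝓝 (∫ t in Set.Ioi (0 : ℝ), F₀ t)) := by
    refine tendsto_integral_filter_of_dominated_convergence
      (fun t => 3 * k * M ^ (a + 1) * (((a + 1) / (1 / 2)) ^ (a + 1) * Real.exp (1 / 2)) *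
        (t ^ a * Real.exp (-(1 / 2) * t))) ?_ ?_
      ((integrableOn_rpow_mul_exp ha (by norm_num)).const_mul _) ?_
    · refine Eventually.of_forall fun r => Measurable.aestronglyMeasurable ?_
      simp only [hF]
      fun_prop
    · filter_upwards [Ioo_mem_nhdsGT one_pos] with r hr
      filter_upwards [ae_restrict_mem measurableSet_Ioi] with t ht
      have ht : 0 < t := ht
      set w : ℂ := (r : ℂ) + Complex.I * ((t / (2 * k) : ℝ) : ℂ) with hw
      have hrw : r ≤ ‖w‖ := by
        have := Complex.re_le_norm w
        rwa [hw, Complex.add_re, Complex.ofReal_re, Complex.I_mul_re, Complex.ofReal_im, neg_zero,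
          add_zero] at this
      have hwpos : 0 < ‖w‖ := hr.1.trans_le hrw
      have hwle : ‖w‖ ≤ 1 + t / (2 * k) := by
        refine (norm_add_le _ _).trans ?_
        rw [norm_mul, Complex.norm_I, one_mul, Complex.norm_real, Complex.norm_real,
          Real.norm_of_nonneg hr.1.le, Real.norm_of_nonneg (by positivity)]
        have := hr.2
        linarith
      -- The linear factor is `-ik(2w - r)`, hence comparable to `w`. It compensates `|w|^a`, which
      -- is singular for negative `a`: the product is of order `|w|^{a+1}` with a positive exponent.
      have h1 : ‖(t : ℂ) - Complex.I * (k * r)‖ ≤ 3 * k * ‖w‖ := by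
        have hk' : (k : ℂ) ≠ 0 := by exact_mod_cast hk.ne'
        have : (t : ℂ) - Complex.I * (k * r) = -(Complex.I * k) * (2 * w - r) := by
          rw [hw]
          push_cast
          field_simp
          ring_nf
          rw [Complex.I_sq]
          ring
        rw [this, norm_mul, norm_neg, norm_mul, Complex.norm_I, one_mul, Complex.norm_real,
          Real.norm_of_nonneg hk.le]
        have h2 : ‖2 * w - r‖ ≤ 3 * ‖w‖ := by
          refine (norm_sub_le _ _).trans ?_
          rw [norm_mul, Complex.norm_real, Real.norm_of_nonneg hr.1.le, Complex.norm_ofNat]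
          linarith
        nlinarith
      have h3 : 1 + t / (2 * k) ≤ M * (1 + t) := by
        have : t / (2 * k) = 1 / (2 * k) * t := by ring
        have h0 : 0 < 1 / (2 * k) := by positivity
        rw [hM]
        nlinarith [mul_pos h0 ht]
      have ha1 : 0 < a + 1 := by linarith
      have h4 : ‖w‖ ^ (a + 1) ≤ M ^ (a + 1) * ((((a + 1) / (1 / 2)) ^ (a + 1) *
          Real.exp (1 / 2)) * Real.exp (1 / 2 * t)) := by
        calc ‖w‖ ^ (a + 1) ≤ (M * (1 + t)) ^ (a + 1) := by
              gcongr
              exact hwle.trans h3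
          _ = M ^ (a + 1) * (1 + t) ^ (a + 1) := Real.mul_rpow hMpos.le (by positivity)
          _ ≤ _ := by
              gcongr
              exact one_add_rpow_le_exp (by linarith) (by norm_num) ht.le
      rw [norm_mul, norm_mul, Complex.norm_real, Real.norm_of_nonneg (by positivity),
        Complex.norm_cpow_real]
      calc _ ≤ 3 * k * ‖w‖ * (Real.exp (-t) * t ^ a) * ‖w‖ ^ a := by gcongr
        _ = 3 * k * (Real.exp (-t) * t ^ a) * ‖w‖ ^ (a + 1) := by
            rw [Real.rpow_add_one hwpos.ne']; ring
        _ ≤ 3 * k * (Real.exp (-t) * t ^ a) * (M ^ (a + 1) * ((((a + 1) / (1 / 2)) ^ (a + 1) *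
          Real.exp (1 / 2)) * Real.exp (1 / 2 * t))) := by gcongr
        _ = _ := by
            have : Real.exp (-(1 / 2) * t) = Real.exp (-t) * Real.exp (1 / 2 * t) := by
              rw [← Real.exp_add]; ring_nf
            rw [this]
            ring
    · filter_upwards [ae_restrict_mem measurableSet_Ioi] with t ht
      have ht : 0 < t := ht
      have hsl : ((0 : ℝ) : ℂ) + Complex.I * ((t / (2 * k) : ℝ) : ℂ) ∈ Complex.slitPlane := by
        right
        rw [Complex.add_im, Complex.ofReal_im, zero_add, Complex.I_mul_im, Complex.ofReal_re]
        positivity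
      have hcont : ContinuousAt (fun r : ℝ => F r t) 0 := by
        refine ContinuousAt.mul (by fun_prop) ?_
        exact ContinuousAt.cpow (by fun_prop) continuousAt_const hsl
      have := hcont.tendsto.mono_left (nhdsWithin_le_nhds (s := Set.Ioi 0))
      convert this using 2
      simp only [hF, hF₀]
      have e1 : ((0 : ℝ) : ℂ) + Complex.I * ((t / (2 * k) : ℝ) : ℂ) =
          ((1 / (2 * k) : ℝ) : ℂ) * ((t : ℂ) * Complex.I) := by push_cast; ring
      have ht' : (t : ℂ) ≠ 0 := by exact_mod_cast ht.ne'
      have e2 : t ^ (2 * a + 2 - 1) = t * t ^ a * t ^ a := by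
        rw [mul_assoc, ← Real.rpow_add ht, mul_comm t, ← Real.rpow_add_one ht.ne']
        ring_nf
      rw [e1, ofReal_mul_cpow (by positivity) (mul_ne_zero ht' Complex.I_ne_zero),
        ofReal_mul_cpow ht Complex.I_ne_zero, e2]
      push_cast
      ring
  have hval : ∫ t in Set.Ioi (0 : ℝ), F₀ t =
      ((1 / (2 * k)) ^ a * Real.Gamma (2 * a + 2) : ℝ) * Complex.I ^ (a : ℂ) := by
    rw [Real.Gamma_eq_integral (by linarith)]
    simp only [hF₀]
    rw [integral_const_mul, integral_complex_ofReal]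
    push_cast
    ring
  have hexp : Tendsto (fun r : ℝ => Complex.exp (Complex.I * (k * r))) (𝓝[>] 0) (𝓝 1) := by
    have : Continuous (fun r : ℝ => Complex.exp (Complex.I * (k * r))) := by fun_prop
    have h := this.tendsto 0
    simp only [Complex.ofReal_zero, mul_zero, Complex.exp_zero] at h
    exact h.mono_left nhdsWithin_le_nhds
  have := hexp.mul hlim
  rw [one_mul, hval] at this
  refine this.congr' ?_
  filter_upwards [self_mem_nhdsWithin] with r hr
  exact (rpow_mul_laplaceMoment_one a k hr).symm

/-- The phases multiply to `-i`, which cancels the factor `i` of `i/4`; Legendre's duplication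
formula handles the Gamma factors. For `a = (n-3)/2` the value is the reciprocal of the area of the
unit sphere. -/
theorem laplaceConst_mul {a k : ℝ} (ha : -1 < a) (hk : 0 < k) :
    laplaceConst a k *
      (((1 / (2 * k)) ^ a * Real.Gamma (2 * a + 2) : ℝ) * Complex.I ^ (a : ℂ)) =
      ((Real.Gamma (a + 3 / 2) / (2 * Real.pi ^ (a + 3 / 2)) : ℝ) : ℂ) := by
  have h1 : Complex.exp (-(Complex.I * (((a + 1) * (Real.pi / 2) : ℝ) : ℂ))) *
      Complex.I ^ (a : ℂ) = -Complex.I := by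
    rw [Complex.cpow_def_of_ne_zero Complex.I_ne_zero, ← Complex.exp_add, Complex.log_I]
    have : -(Complex.I * (((a + 1) * (Real.pi / 2) : ℝ) : ℂ)) + ↑Real.pi / 2 * Complex.I * a =
      -(Real.pi / 2 * Complex.I) := by push_cast; ring
    rw [this, Complex.exp_neg, Complex.exp_pi_div_two_mul_I, Complex.inv_I]
  have hpi := Real.pi_pos
  have hG : 0 < Real.Gamma (a + 1) := Real.Gamma_pos_of_pos (by linarith)
  have h2 : (1 / 4) * ((k / (2 * Real.pi)) ^ (a + 1 / 2) * Real.sqrt (2 / (Real.pi * k)) /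
    Real.Gamma (a + 1)) * ((1 / (2 * k)) ^ a * Real.Gamma (2 * a + 2)) =
      Real.Gamma (a + 3 / 2) / (2 * Real.pi ^ (a + 3 / 2)) := by
    have hL := Real.Gamma_mul_Gamma_add_half (a + 1)
    have e1 : a + 1 + 1 / 2 = a + 3 / 2 := by ring
    have e2 : 2 * (a + 1) = 2 * a + 2 := by ring
    have e3 : (2 : ℝ) ^ (1 - (2 * a + 2)) = 1 / (2 * (2 ^ a * 2 ^ a)) := by
      have : (1 : ℝ) - (2 * a + 2) = -(a + a + 1) := by ring
      rw [this, Real.rpow_neg (by norm_num), Real.rpow_add_one (by norm_num),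
        Real.rpow_add (by norm_num)]
      field_simp
    rw [e1, e2, e3] at hL
    have e4 : (k / (2 * Real.pi)) ^ (a + 1 / 2) = k ^ a * Real.sqrt k /
        (2 ^ a * Real.sqrt 2 * (Real.pi ^ a * Real.sqrt Real.pi)) := by
      rw [Real.div_rpow hk.le (by positivity), Real.mul_rpow (by norm_num) hpi.le,
        Real.rpow_add hk, Real.rpow_add hpi, Real.rpow_add (by norm_num), ← Real.sqrt_eq_rpow,
        ← Real.sqrt_eq_rpow, ← Real.sqrt_eq_rpow]
    have e5 : Real.sqrt (2 / (Real.pi * k)) = Real.sqrt 2 / (Real.sqrt Real.pi * Real.sqrt k) := by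
      rw [Real.sqrt_div (by norm_num), Real.sqrt_mul hpi.le]
    have e6 : (1 / (2 * k)) ^ a = 1 / (2 ^ a * k ^ a) := by
      rw [Real.div_rpow (by norm_num) (by positivity), Real.one_rpow,
        Real.mul_rpow (by norm_num) hk.le]
    have e7 : Real.pi ^ (a + 3 / 2) = Real.pi ^ a * (Real.pi * Real.sqrt Real.pi) := by
      have : a + 3 / 2 = a + (1 + 1 / 2) := by ring
      rw [this, Real.rpow_add hpi, Real.rpow_add hpi, Real.rpow_one, ← Real.sqrt_eq_rpow]
    have e8 : Real.sqrt Real.pi * Real.sqrt Real.pi = Real.pi := Real.mul_self_sqrt hpi.le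
    have h8 : 0 < Real.sqrt Real.pi := Real.sqrt_pos.mpr hpi
    have h9 : 0 < Real.sqrt k := Real.sqrt_pos.mpr hk
    have h10 : 0 < k ^ a := by positivity
    have h11 : 0 < Real.pi ^ a := by positivity
    have h12 : (0 : ℝ) < 2 ^ a := by positivity
    have hL' : Real.Gamma (a + 3 / 2) = Real.Gamma (2 * a + 2) *
        (1 / (2 * (2 ^ a * 2 ^ a))) * Real.sqrt Real.pi / Real.Gamma (a + 1) := by
      rw [eq_div_iff hG.ne', ← hL]; ring
    rw [e4, e5, e6, e7, hL']
    generalize Real.sqrt Real.pi = s at *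
    rw [← e8]
    field_simp
    norm_num
  rw [← h2, laplaceConst]
  set c : ℂ := (((k / (2 * Real.pi)) ^ (a + 1 / 2) : ℝ) : ℂ) *
    (Real.sqrt (2 / (Real.pi * k)) : ℂ) / (Real.Gamma (a + 1) : ℂ) *
    (((1 / (2 * k)) ^ a : ℝ) : ℂ) * (Real.Gamma (2 * a + 2) : ℂ) with hc
  simp only [Complex.ofReal_mul _ _, Complex.ofReal_div _ _, Complex.ofReal_ofNat,
    Complex.ofReal_one] at h1 hc ⊢
  linear_combination (Complex.I / 4 * c) * h1 - c / 4 * Complex.I_sq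

/-! ### The radial profile solves the Helmholtz equation away from the origin -/

/-- The derivative of the radial profile. -/
def radialDeriv (n : ℕ) (k : Wavenumber) (r : ℝ) : ℂ :=
  -(laplaceConst (((n : ℝ) - 3) / 2) k * laplaceMoment (((n : ℝ) - 3) / 2) k 1 r)

theorem neg_one_lt_exponent {n : ℕ} (hn : 2 ≤ n) : -1 < ((n : ℝ) - 3) / 2 := by
  have : (2 : ℝ) ≤ n := by exact_mod_cast hn
  linarith

theorem hasDerivAt_radialSolution {n : ℕ} (hn : 2 ≤ n) (k : Wavenumber) {r : ℝ} (hr : 0 < r) :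
    HasDerivAt (radialSolution n k) (radialDeriv n k r) r := by
  have h := (hasDerivAt_laplaceMoment (neg_one_lt_exponent hn) k.2 0 hr).const_mul
    (laplaceConst (((n : ℝ) - 3) / 2) k)
  rw [mul_neg] at h
  refine h.congr_of_eventuallyEq ?_
  filter_upwards [lt_mem_nhds hr] with s hs
  exact radialSolution_eq n k hs

/-- This is the moment identity divided by `r`, since `2(a + 1) = n - 1`. -/
theorem hasDerivAt_radialDeriv {n : ℕ} (hn : 2 ≤ n) (k : Wavenumber) {r : ℝ} (hr : 0 < r) :
    HasDerivAt (radialDeriv n k)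
      (-((k : ℂ) ^ 2 * radialSolution n k r + ((n : ℂ) - 1) / r * radialDeriv n k r)) r := by
  have h := ((hasDerivAt_laplaceMoment (neg_one_lt_exponent hn) k.2 1 hr).const_mul
    (laplaceConst (((n : ℝ) - 3) / 2) k)).neg
  refine h.congr_deriv ?_
  have e := laplaceMoment_equation (neg_one_lt_exponent hn) k.2 hr
  have hr' : (r : ℂ) ≠ 0 := by exact_mod_cast hr.ne'
  rw [radialSolution_eq n k hr, radialDeriv]
  push_cast at e ⊢
  field_simp
  linear_combination laplaceConst (((n : ℝ) - 3) / 2) k * e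

/-- The limit is minus the reciprocal of the area of the unit sphere, so that the flux of `∇G`
through small spheres tends to `-1`. -/
theorem tendsto_pow_mul_radialDeriv {n : ℕ} (hn : 2 ≤ n) (k : Wavenumber) :
    Tendsto (fun r : ℝ => (r : ℂ) ^ (n - 1) * radialDeriv n k r) (𝓝[>] 0)
      (𝓝 (-((Real.Gamma (n / 2) / (2 * Real.pi ^ ((n : ℝ) / 2)) : ℝ) : ℂ))) := by
  have ha := neg_one_lt_exponent hn
  have h := ((tendsto_laplaceMoment_one ha k.2).const_mul
    (laplaceConst (((n : ℝ) - 3) / 2) k)).neg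
  rw [laplaceConst_mul ha k.2] at h
  have e1 : ((n : ℝ) - 3) / 2 + 3 / 2 = n / 2 := by ring
  have e2 : 2 * (((n : ℝ) - 3) / 2) + 2 = ((n - 1 : ℕ) : ℝ) := by
    rw [Nat.cast_sub (by omega)]; push_cast; ring
  rw [e1] at h
  refine h.congr fun r => ?_
  rw [e2, Real.rpow_natCast, radialDeriv]
  push_cast
  ring

/-- The crude bound `r^{3/2 - n}` suffices, as it leaves `r^{3/2}`. -/
theorem tendsto_pow_mul_radialSolution {n : ℕ} (hn : 2 ≤ n) (k : Wavenumber) :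
    Tendsto (fun r : ℝ => (r : ℂ) ^ n * radialSolution n k r) (𝓝[>] 0) (𝓝 0) := by
  obtain ⟨C, hC⟩ := norm_radialSolution_le hn k one_pos
  have h1 : Tendsto (fun r : ℝ => C * r ^ (3 / 2 : ℝ)) (𝓝[>] 0) (𝓝 0) := by
    have : Continuous (fun r : ℝ => C * r ^ (3 / 2 : ℝ)) :=
      (Real.continuous_rpow_const (by norm_num)).const_mul C
    have h := this.tendsto 0
    rw [Real.zero_rpow (by norm_num), mul_zero] at h
    exact h.mono_left nhdsWithin_le_nhds
  refine squeeze_zero_norm' ?_ h1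
  filter_upwards [Ioo_mem_nhdsGT one_pos] with r hr
  have hr0 : 0 < r := hr.1
  rw [norm_mul, norm_pow, Complex.norm_real, Real.norm_of_nonneg hr0.le]
  have e : r ^ (3 / 2 : ℝ) = r ^ n * r ^ (3 / 2 - n : ℝ) := by
    rw [← Real.rpow_natCast, ← Real.rpow_add hr0]
    ring_nf
  rw [e]
  calc _ ≤ r ^ n * (C * r ^ (3 / 2 - n : ℝ)) := by
        gcongr
        exact hC r hr
    _ = _ := by ring

/-- The density of the flux `n r^{n-1} G'(r) + k² r^n G(r)` of the radial profile. -/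
def radialFlux (n : ℕ) (k : Wavenumber) (r : ℝ) : ℂ :=
  n * ((r : ℂ) ^ (n - 1) * radialDeriv n k r) +
    (k : ℂ) ^ 2 * ((r : ℂ) ^ n * radialSolution n k r)

theorem tendsto_radialFlux {n : ℕ} (hn : 2 ≤ n) (k : Wavenumber) :
    Tendsto (radialFlux n k) (𝓝[>] 0)
      (𝓝 (n * -((Real.Gamma (n / 2) / (2 * Real.pi ^ ((n : ℝ) / 2)) : ℝ) : ℂ))) := by
  have := ((tendsto_pow_mul_radialDeriv hn k).const_mul (n : ℂ)).add
    ((tendsto_pow_mul_radialSolution hn k).const_mul ((k : ℂ) ^ 2))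
  rwa [mul_zero, add_zero] at this

theorem continuousOn_radialSolution {n : ℕ} (hn : 2 ≤ n) (k : Wavenumber) :
    ContinuousOn (radialSolution n k) (Set.Ioi 0) := fun _ hr =>
  (hasDerivAt_radialSolution hn k hr).continuousAt.continuousWithinAt

theorem continuousOn_radialDeriv {n : ℕ} (hn : 2 ≤ n) (k : Wavenumber) :
    ContinuousOn (radialDeriv n k) (Set.Ioi 0) := fun _ hr =>
  (hasDerivAt_radialDeriv hn k hr).continuousAt.continuousWithinAt

theorem continuousOn_radialFlux {n : ℕ} (hn : 2 ≤ n) (k : Wavenumber) :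
    ContinuousOn (radialFlux n k) (Set.Ioi 0) := by
  have h1 := continuousOn_radialSolution hn k
  have h2 := continuousOn_radialDeriv hn k
  unfold radialFlux
  fun_prop

/-- Near the origin the flux has a limit; on the remaining compact interval it is continuous. -/
theorem exists_norm_radialFlux_le {n : ℕ} (hn : 2 ≤ n) (k : Wavenumber) (R : ℝ) :
    ∃ C : ℝ, 0 ≤ C ∧ ∀ r, 0 < r → r ≤ R → ‖radialFlux n k r‖ ≤ C := by
  obtain ⟨C, hC⟩ := (tendsto_radialFlux hn k).norm.isBoundedUnder_le
  rw [eventually_map] at hC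
  obtain ⟨δ, hδ, hδC⟩ := mem_nhdsGT_iff_exists_Ioo_subset.mp hC
  have hδ : 0 < δ := hδ
  obtain ⟨C', hC'⟩ := isCompact_Icc.exists_bound_of_continuousOn (s := Set.Icc δ R)
    ((continuousOn_radialFlux hn k).mono fun r hr => hδ.trans_le hr.1)
  refine ⟨max 0 (max C C'), le_max_left _ _, fun r hr hrR => ?_⟩
  by_cases h : r < δ
  · exact (hδC ⟨hr, h⟩ : ‖radialFlux n k r‖ ≤ C).trans
      ((le_max_left _ _).trans (le_max_right _ _))
  · exact (hC' r ⟨not_lt.mp h, hrR⟩).trans ((le_max_right _ _).trans (le_max_right _ _))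

/-! ### Integration by parts against radial functions -/

section IntegrationByParts

variable {n : ℕ}

theorem hasCompactSupport_lineDerivOp {f : 𝓢(EuclideanSpace ℝ (Fin n), ℂ)}
    (hf : HasCompactSupport f) (v : EuclideanSpace ℝ (Fin n)) : 
    HasCompactSupport ⇑(∂_{v} f : 𝓢(EuclideanSpace ℝ (Fin n), ℂ)) := by
  have : ⇑(∂_{v} f : 𝓢(EuclideanSpace ℝ (Fin n), ℂ)) = fun x => fderiv ℝ f x v := by
    ext x
    exact SchwartzMap.lineDerivOp_apply_eq_fderiv v f x
  rw [this]
  exact hf.fderiv_apply ℝ v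

theorem integral_mul_lineDerivOp_eq_neg {F F' : EuclideanSpace ℝ (Fin n) → ℂ}
    {v : EuclideanSpace ℝ (Fin n)} (hF : Continuous F) (hF' : Continuous F')
    (hd : ∀ x, HasLineDerivAt ℝ F (F' x) x v) {f : 𝓢(EuclideanSpace ℝ (Fin n), ℂ)}
    (hf : HasCompactSupport f) : ∫ x, F x * ∂_{v} f x = -∫ x, F' x * f x := by
  refine integral_bilinear_hasLineDerivAt_right_eq_neg_left_of_integrable
    (B := ContinuousLinearMap.mul ℝ ℂ) (v := v) ?_ ?_ ?_ (fun x _ => hd x)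
    (fun x _ => ?_)
  · exact (hF'.mul f.continuous).integrable_of_hasCompactSupport hf.mul_left
  · exact (hF.mul (∂_{v} f).continuous).integrable_of_hasCompactSupport
      (hasCompactSupport_lineDerivOp hf v).mul_left
  · exact (hF.mul f.continuous).integrable_of_hasCompactSupport hf.mul_left
  · rw [SchwartzMap.lineDerivOp_apply_eq_fderiv]
    exact (f.differentiableAt.hasFDerivAt (x := x)).hasLineDerivAt v

theorem hasLineDerivAt_comp_norm_sq {Q : ℝ → ℂ} {Q' : ℂ} {c : ℝ}
    (a v x : EuclideanSpace ℝ (Fin n)) (hQ : HasDerivAt Q Q' (‖x - a‖ ^ 2 + c)) :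
    HasLineDerivAt ℝ (fun z => Q (‖z - a‖ ^ 2 + c))
      ((2 * inner ℝ (x - a) v : ℝ) * Q') x v := by
  have h1 : HasFDerivAt (fun z : EuclideanSpace ℝ (Fin n) => ‖z - a‖ ^ 2 + c)
      (2 • (innerSL ℝ (x - a)).comp (ContinuousLinearMap.id ℝ _)) x :=
    (((hasFDerivAt_id x).sub_const a).norm_sq).add_const c
  have h2 := HasDerivAt.scomp_of_eq (x := (0 : ℝ)) (h := fun t : ℝ => ‖x + t • v - a‖ ^ 2 + c)
    (g₁ := Q) (by simpa using hQ) (h1.hasLineDerivAt v) (by simp)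
  refine HasDerivAt.congr_deriv h2 ?_
  simp [inner_sub_left]

/-- Integrate by parts twice in each coordinate direction and sum with `∑ ⟨x - a, e_i⟩² = |x - a|²`.
Working in the squared distance avoids differentiating the norm, and `c > 0` keeps the argument away
from the singularity. -/
theorem integral_radial_mul_laplacian {Q Q₁ Q₂ : ℝ → ℂ}
    (hQ : ∀ s, 0 < s → HasDerivAt Q (Q₁ s) s) (hQ₁ : ∀ s, 0 < s → HasDerivAt Q₁ (Q₂ s) s)
    (hQ₂ : ContinuousOn Q₂ (Set.Ioi 0)) {c : ℝ} (hc : 0 < c) (a : EuclideanSpace ℝ (Fin n))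
    {f : 𝓢(EuclideanSpace ℝ (Fin n), ℂ)} (hf : HasCompactSupport f) :
    ∫ x, Q (‖x - a‖ ^ 2 + c) * Δ f x =
      ∫ x, ((4 * ‖x - a‖ ^ 2 : ℝ) * Q₂ (‖x - a‖ ^ 2 + c) +
        2 * n * Q₁ (‖x - a‖ ^ 2 + c)) * f x := by
  have hpos : ∀ x : EuclideanSpace ℝ (Fin n), 0 < ‖x - a‖ ^ 2 + c := fun x => by positivity
  have hs : Continuous fun x : EuclideanSpace ℝ (Fin n) => ‖x - a‖ ^ 2 + c := by fun_prop
  have hcomp : ∀ {P : ℝ → ℂ}, ContinuousOn P (Set.Ioi 0) →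
      Continuous fun x : EuclideanSpace ℝ (Fin n) => P (‖x - a‖ ^ 2 + c) := fun hP =>
    hP.comp_continuous hs hpos
  have c0 := hcomp (fun s hs => (hQ s hs).continuousAt.continuousWithinAt)
  have c1 := hcomp (fun s hs => (hQ₁ s hs).continuousAt.continuousWithinAt)
  have c2 := hcomp hQ₂
  have m2 : ∀ v : EuclideanSpace ℝ (Fin n),
      Continuous fun x => ((4 * inner ℝ (x - a) v ^ 2 : ℝ) : ℂ) := fun v => by fun_prop
  have c3 : ∀ v : EuclideanSpace ℝ (Fin n),
      Continuous fun x => ((4 * inner ℝ (x - a) v ^ 2 : ℝ) : ℂ) * Q₂ (‖x - a‖ ^ 2 + c) +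
        2 * Q₁ (‖x - a‖ ^ 2 + c) := fun v => ((m2 v).mul c2).add (continuous_const.mul c1)
  let b := EuclideanSpace.basisFun (Fin n) ℝ
  have hi : ∀ v : EuclideanSpace ℝ (Fin n), ‖v‖ = 1 →
      ∫ x, Q (‖x - a‖ ^ 2 + c) * ∂_{v} (∂_{v} f) x =
      ∫ x, ((4 * inner ℝ (x - a) v ^ 2 : ℝ) * Q₂ (‖x - a‖ ^ 2 + c) +
        2 * Q₁ (‖x - a‖ ^ 2 + c)) * f x := by
    intro v hv
    have c4 : Continuous fun x => ((2 * inner ℝ (x - a) v : ℝ) : ℂ) * Q₁ (‖x - a‖ ^ 2 + c) :=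
      Continuous.mul (by fun_prop) c1
    rw [integral_mul_lineDerivOp_eq_neg (v := v)
      (F' := fun x => (2 * inner ℝ (x - a) v : ℝ) * Q₁ (‖x - a‖ ^ 2 + c)) c0 c4
      (fun x => hasLineDerivAt_comp_norm_sq a v x (hQ _ (hpos x)))
      (hasCompactSupport_lineDerivOp hf v),
      integral_mul_lineDerivOp_eq_neg (v := v)
      (F' := fun x => (4 * inner ℝ (x - a) v ^ 2 : ℝ) * Q₂ (‖x - a‖ ^ 2 + c) +
        2 * Q₁ (‖x - a‖ ^ 2 + c)) c4 (c3 v) (fun x => ?_) hf, neg_neg]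
    have h1 := hasLineDerivAt_comp_norm_sq a v x (hQ₁ _ (hpos x))
    have h2 : HasLineDerivAt ℝ (fun x => ((2 * inner ℝ (x - a) v : ℝ) : ℂ)) (2 : ℂ) x v := by
      have h3 : (fun t : ℝ => ((2 * inner ℝ (x + t • v - a) v : ℝ) : ℂ)) =
          fun t : ℝ => ((2 * inner ℝ (x - a) v + 2 * t : ℝ) : ℂ) := by
        ext t
        rw [add_sub_right_comm, inner_add_left, real_inner_smul_left, real_inner_self_eq_norm_sq,
          hv]
        push_cast
        ring
      have h4 := (((hasDerivAt_id (0 : ℝ)).const_mul 2).const_add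
        (2 * inner ℝ (x - a) v)).ofReal_comp
      rw [HasLineDerivAt, h3]
      simpa using h4
    have h5 := HasDerivAt.mul h2 h1
    refine HasDerivAt.congr_deriv h5 ?_
    simp only [zero_smul, add_zero]
    push_cast
    ring
  have hint : ∀ i, Integrable fun x => ((4 * inner ℝ (x - a) (b i) ^ 2 : ℝ) *
      Q₂ (‖x - a‖ ^ 2 + c) + 2 * Q₁ (‖x - a‖ ^ 2 + c)) * f x := fun i =>
    ((c3 _).mul f.continuous).integrable_of_hasCompactSupport hf.mul_left
  have hint' : ∀ i, Integrable fun x => Q (‖x - a‖ ^ 2 + c) * ∂_{b i} (∂_{b i} f) x := fun i =>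
    Continuous.integrable_of_hasCompactSupport
      (c0.mul (∂_{b i} (∂_{b i} f)).continuous)
      (hasCompactSupport_lineDerivOp (hasCompactSupport_lineDerivOp hf _) _).mul_left
  calc ∫ x, Q (‖x - a‖ ^ 2 + c) * Δ f x =
        ∫ x, ∑ i, Q (‖x - a‖ ^ 2 + c) * ∂_{b i} (∂_{b i} f) x := by
        rw [SchwartzMap.laplacian_eq_sum b]
        simp only [sum_apply, Finset.mul_sum]
    _ = ∑ i, ∫ x, ((4 * inner ℝ (x - a) (b i) ^ 2 : ℝ) * Q₂ (‖x - a‖ ^ 2 + c) +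
        2 * Q₁ (‖x - a‖ ^ 2 + c)) * f x := by
        rw [integral_finsetSum _ fun i _ => hint' i]
        exact Finset.sum_congr rfl fun i _ => hi (b i) (b.norm_eq_one i)
    _ = _ := by
        rw [← integral_finsetSum _ fun i _ => hint i]
        congr 1
        ext x
        rw [← Finset.sum_mul, Finset.sum_add_distrib, ← Finset.sum_mul, ← Complex.ofReal_sum,
          ← Finset.mul_sum, b.sum_sq_inner_left]
        simp only [Finset.sum_const, Finset.card_univ, Fintype.card_fin, nsmul_eq_mul]
        ring

end IntegrationByParts

/-! ### The fundamental solution -/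

section FundamentalSolution

variable {n : ℕ}

theorem hasDerivAt_radialSolution_sqrt (hn : 2 ≤ n) (k : Wavenumber) {s : ℝ} (hs : 0 < s) :
    HasDerivAt (fun s => radialSolution n k √s) (radialDeriv n k √s / (2 * √s)) s := by
  have h := (hasDerivAt_radialSolution hn k (Real.sqrt_pos.mpr hs)).scomp s
    (Real.hasDerivAt_sqrt hs.ne')
  refine h.congr_deriv ?_
  rw [Complex.real_smul]
  push_cast
  ring

/-- In the variable `s = r²`, with `Q(s) = G(√s)`, the radial equation reads `4sQ'' + 2nQ' + k²Q =
0`. -/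
theorem hasDerivAt_radialDeriv_sqrt (hn : 2 ≤ n) (k : Wavenumber) {s : ℝ} (hs : 0 < s) :
    HasDerivAt (fun s => radialDeriv n k √s / (2 * √s))
      (-(2 * n * (radialDeriv n k √s / (2 * √s)) + (k : ℂ) ^ 2 * radialSolution n k √s) /
        (4 * s)) s := by
  have hs' := Real.sqrt_pos.mpr hs
  have h := (hasDerivAt_radialDeriv hn k hs').scomp s (Real.hasDerivAt_sqrt hs.ne')
  have h1 : HasDerivAt (fun s : ℝ => 2 * ((√s : ℝ) : ℂ)) (2 * ((1 / (2 * √s) : ℝ) : ℂ)) s :=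
    (Real.hasDerivAt_sqrt hs.ne').ofReal_comp.const_mul 2
  have hne : ((√s : ℝ) : ℂ) ≠ 0 := by exact_mod_cast hs'.ne'
  have h2 := h.div h1 (mul_ne_zero two_ne_zero hne)
  refine h2.congr_deriv ?_
  have e : (s : ℂ) = ((√s : ℝ) : ℂ) ^ 2 := by
    rw [← Complex.ofReal_pow, Real.sq_sqrt hs.le]
  rw [Complex.real_smul, e]
  push_cast
  simp only [Function.comp_apply]
  field_simp
  ring

theorem tsupport_lineDerivOp_subset (f : 𝓢(EuclideanSpace ℝ (Fin n), ℂ))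
    (v : EuclideanSpace ℝ (Fin n)) :
    tsupport ⇑(∂_{v} f : 𝓢(EuclideanSpace ℝ (Fin n), ℂ)) ⊆ tsupport f := by
  have : ⇑(∂_{v} f : 𝓢(EuclideanSpace ℝ (Fin n), ℂ)) = fun x => fderiv ℝ f x v := by
    ext x
    exact SchwartzMap.lineDerivOp_apply_eq_fderiv v f x
  rw [this]
  exact tsupport_fderiv_apply_subset ℝ v

theorem tsupport_laplacian_subset (f : 𝓢(EuclideanSpace ℝ (Fin n), ℂ)) :
    tsupport ⇑(Δ f : 𝓢(EuclideanSpace ℝ (Fin n), ℂ)) ⊆ tsupport f := by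
  refine closure_minimal (fun x hx => ?_) (isClosed_tsupport _)
  contrapose! hx
  rw [Function.mem_support, not_not, SchwartzMap.laplacian_eq_sum (EuclideanSpace.basisFun _ ℝ),
    sum_apply]
  refine Finset.sum_eq_zero fun i _ => image_eq_zero_of_notMem_tsupport fun h => hx ?_
  exact tsupport_lineDerivOp_subset _ _ (tsupport_lineDerivOp_subset _ _ h)

theorem hasCompactSupport_laplacian {f : 𝓢(EuclideanSpace ℝ (Fin n), ℂ)}
    (hf : HasCompactSupport f) :
    HasCompactSupport ⇑(Δ f : 𝓢(EuclideanSpace ℝ (Fin n), ℂ)) :=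
  hf.mono' (tsupport_laplacian_subset f |> (subset_tsupport _).trans)

/-- The regularisation `G(√(|x - a|² + δ²))` of the fundamental solution. -/
theorem integral_regularised_mul_helmholtz (hn : 2 ≤ n) (k : Wavenumber) {δ : ℝ} (hδ : 0 < δ)
    (a : EuclideanSpace ℝ (Fin n)) {f : 𝓢(EuclideanSpace ℝ (Fin n), ℂ)}
    (hf : HasCompactSupport f) :
    ∫ x, radialSolution n k √(‖x - a‖ ^ 2 + δ ^ 2) * (Δ f x + (k : ℂ) ^ 2 * f x) =
      ∫ x, ((δ ^ 2 / √(‖x - a‖ ^ 2 + δ ^ 2) ^ (n + 2) : ℝ) : ℂ) *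
        radialFlux n k √(‖x - a‖ ^ 2 + δ ^ 2) * f x := by
  have hδ2 : 0 < δ ^ 2 := by positivity
  have hpos : ∀ x : EuclideanSpace ℝ (Fin n), 0 < ‖x - a‖ ^ 2 + δ ^ 2 := fun x => by positivity
  have d0 := fun s hs => hasDerivAt_radialSolution_sqrt (s := s) hn k hs
  have d1 := fun s hs => hasDerivAt_radialDeriv_sqrt (s := s) hn k hs
  have k0 : ContinuousOn (fun s => radialSolution n k √s) (Set.Ioi 0) := fun s hs =>
    (d0 s hs).continuousAt.continuousWithinAt
  have k1 : ContinuousOn (fun s => radialDeriv n k √s / (2 * √s)) (Set.Ioi 0) := fun s hs =>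
    (d1 s hs).continuousAt.continuousWithinAt
  have k2 : ContinuousOn (fun s : ℝ => -(2 * n * (radialDeriv n k √s / (2 * √s)) +
      (k : ℂ) ^ 2 * radialSolution n k √s) / (4 * s)) (Set.Ioi 0) := by
    refine ContinuousOn.div ?_ (by fun_prop) fun s hs => ?_
    · exact ((k1.const_mul _).add (k0.const_mul _)).neg
    · have : (s : ℂ) ≠ 0 := by exact_mod_cast (ne_of_gt hs)
      simpa using this
  have key := integral_radial_mul_laplacian d0 d1 k2 hδ2 a hf
  have hs : Continuous fun x : EuclideanSpace ℝ (Fin n) => ‖x - a‖ ^ 2 + δ ^ 2 := by fun_prop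
  have c0 := k0.comp_continuous hs hpos
  have c1 := k1.comp_continuous hs hpos
  have c2 := k2.comp_continuous hs hpos
  have m2 : Continuous fun x : EuclideanSpace ℝ (Fin n) =>
    ((4 * ‖x - a‖ ^ 2 : ℝ) : ℂ) := by fun_prop
  have i1 : Integrable fun x => radialSolution n k √(‖x - a‖ ^ 2 + δ ^ 2) * Δ f x :=
    (c0.mul (Δ f).continuous).integrable_of_hasCompactSupport (hasCompactSupport_laplacian hf).mul_left
  have i2 : Integrable fun x => radialSolution n k √(‖x - a‖ ^ 2 + δ ^ 2) *
      ((k : ℂ) ^ 2 * f x) :=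
    (c0.mul (continuous_const.mul f.continuous)).integrable_of_hasCompactSupport
      hf.mul_left.mul_left
  simp only [mul_add]
  rw [integral_add i1 i2, key, ← integral_add ?_ i2]
  · congr 1
    ext x
    set ρ : ℝ := √(‖x - a‖ ^ 2 + δ ^ 2) with hρ
    have hρ0 : 0 < ρ := Real.sqrt_pos.mpr (hpos x)
    have hne : (ρ : ℂ) ≠ 0 := by exact_mod_cast hρ0.ne'
    have e : ‖x - a‖ ^ 2 + δ ^ 2 = ρ ^ 2 := (Real.sq_sqrt (hpos x).le).symm
    -- With `|x - a|² = ρ² - δ²` the `ρ²` part cancels by the radial equation. Only `-4δ²Q''`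
    -- survives, which is `δ² ρ^{-(n+2)}` times the flux.
    have e' : ‖x - a‖ ^ 2 = ρ ^ 2 - δ ^ 2 := by linarith
    have en : (ρ : ℂ) ^ n = ρ ^ (n - 1) * ρ := by
      rw [← pow_succ, Nat.sub_add_cancel (by omega)]
    rw [e, e', radialFlux]
    push_cast
    rw [pow_add, en]
    field_simp
    ring
  · exact ((m2.mul c2).add (continuous_const.mul c1)).mul f.continuous
      |>.integrable_of_hasCompactSupport hf.mul_left

/-! ### Letting the regularisation parameter tend to zero -/

theorem integral_one_add_norm_sq (hn : 2 ≤ n) :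
    ∫ y : EuclideanSpace ℝ (Fin n), 1 / √(‖y‖ ^ 2 + 1) ^ (n + 2) =
      √Real.pi ^ n / Real.Gamma (n / 2 + 1) := by
  have : Nonempty (Fin n) := ⟨⟨0, by omega⟩⟩
  rw [integral_fun_norm_addHaar volume (fun r : ℝ => 1 / √(r ^ 2 + 1) ^ (n + 2)),
    finrank_euclideanSpace_fin]
  have hball : volume.real (Metric.ball (0 : EuclideanSpace ℝ (Fin n)) 1) =
      √Real.pi ^ n / Real.Gamma (n / 2 + 1) := by
    have hG : 0 < Real.Gamma ((n : ℝ) / 2 + 1) := Real.Gamma_pos_of_pos (by positivity)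
    rw [Measure.real, EuclideanSpace.volume_ball, Fintype.card_fin, ENNReal.ofReal_one, one_pow,
      one_mul, ENNReal.toReal_ofReal (by positivity)]
  have hint : ∫ r in Set.Ioi (0 : ℝ), r ^ (n - 1) • (1 / √(r ^ 2 + 1) ^ (n + 2)) =
      1 / n := by
    -- In polar coordinates the integrand has the primitive `(r/√(r² + 1))^n / n`, so the total mass
    -- is the volume of the unit ball.
    have hd : ∀ r ∈ Set.Ici (0 : ℝ), HasDerivAt (fun r : ℝ => (r / √(r ^ 2 + 1)) ^ n / n)
        (r ^ (n - 1) • (1 / √(r ^ 2 + 1) ^ (n + 2))) r := by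
      intro r _
      have hp : 0 < r ^ 2 + 1 := by positivity
      have h1 : HasDerivAt (fun r : ℝ => r ^ 2 + 1) (2 * r) r := by
        simpa using (hasDerivAt_pow 2 r).add_const 1
      have h2 := (((hasDerivAt_id r).div (h1.sqrt hp.ne') (Real.sqrt_pos.mpr hp).ne').pow
        n).div_const (n : ℝ)
      refine h2.congr_deriv ?_
      have hq : 0 < √(r ^ 2 + 1) := Real.sqrt_pos.mpr hp
      have hq2 : √(r ^ 2 + 1) ^ 2 = r ^ 2 + 1 := Real.sq_sqrt hp.le
      have hn0 : (n : ℝ) ≠ 0 := by positivity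
      obtain ⟨m, rfl⟩ : ∃ m, n = m + 1 := ⟨n - 1, by omega⟩
      simp only [id_eq, Nat.add_sub_cancel, smul_eq_mul, Pi.div_apply]
      generalize √(r ^ 2 + 1) = q at *
      rw [div_pow]
      have e : (1 * q - r * (2 * r / (2 * q))) / q ^ 2 = 1 / q ^ 3 := by
        field_simp
        linear_combination hq2
      rw [e]
      field_simp
      ring
    have hlim : Tendsto (fun r : ℝ => (r / √(r ^ 2 + 1)) ^ n / n) atTop (𝓝 (1 / n)) := by
      have h1 : Tendsto (fun r : ℝ => √(1 / (1 + (r⁻¹) ^ 2))) atTop (𝓝 1) := by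
        have : Tendsto (fun r : ℝ => √(1 / (1 + (r⁻¹) ^ 2))) atTop
            (𝓝 √(1 / (1 + (0 : ℝ) ^ 2))) :=
          ((tendsto_const_nhds.div (tendsto_const_nhds.add (tendsto_inv_atTop_zero.pow 2))
            (by norm_num))).sqrt
        simpa using this
      have h2 : Tendsto (fun r : ℝ => r / √(r ^ 2 + 1)) atTop (𝓝 1) := by
        refine h1.congr' ?_
        filter_upwards [eventually_gt_atTop 0] with r hr
        have : 1 / (1 + r⁻¹ ^ 2) = r ^ 2 / (r ^ 2 + 1) := by field_simp
        rw [this, Real.sqrt_div (by positivity), Real.sqrt_sq hr.le]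
      have := (h2.pow n).div_const (n : ℝ)
      rwa [one_pow] at this
    have := integral_Ioi_of_hasDerivAt_of_nonneg' hd
      (fun r hr => by have hr : 0 < r := hr; positivity) hlim
    rw [this]
    simp [show n ≠ 0 by omega]
  rw [hint, hball]
  have hn0 : (n : ℝ) ≠ 0 := by positivity
  simp only [nsmul_eq_mul, smul_eq_mul]
  field_simp

theorem integrable_one_div_sqrt_pow :
    Integrable fun y : EuclideanSpace ℝ (Fin n) => 1 / √(‖y‖ ^ 2 + 1) ^ (n + 2) := by
  have := integrable_rpow_neg_one_add_norm_sq (E := EuclideanSpace ℝ (Fin n)) (μ := volume)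
    (r := n + 2) (by rw [finrank_euclideanSpace_fin]; linarith)
  refine this.congr (Eventually.of_forall fun y => ?_)
  have hp : 0 < 1 + ‖y‖ ^ 2 := by positivity
  simp only
  have e : √(‖y‖ ^ 2 + 1) ^ (n + 2) = (1 + ‖y‖ ^ 2) ^ (((n : ℝ) + 2) / 2) := by
    rw [Real.sqrt_eq_rpow, add_comm (‖y‖ ^ 2),
      ← Real.rpow_natCast ((1 + ‖y‖ ^ 2) ^ (1 / 2 : ℝ)) (n + 2), ← Real.rpow_mul hp.le]
    congr 1
    push_cast
    ring
  rw [neg_div, Real.rpow_neg hp.le, e, one_div]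

/-- The scaling `x = δy` exhibits an approximate identity. Its mass is the volume of the unit ball
times the limit `-n/|S^{n-1}|` of the flux, that is `-1`. -/
theorem tendsto_integral_radialFlux (hn : 2 ≤ n) (k : Wavenumber)
    {h : EuclideanSpace ℝ (Fin n) → ℂ} (hc : Continuous h) (hs : HasCompactSupport h) :
    Tendsto (fun δ : ℝ => ∫ x, ((δ ^ 2 / √(‖x‖ ^ 2 + δ ^ 2) ^ (n + 2) : ℝ) : ℂ) *
        radialFlux n k √(‖x‖ ^ 2 + δ ^ 2) * h x) (𝓝[>] 0) (𝓝 (-h 0)) := by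
  obtain ⟨R, hR0, hR⟩ : ∃ R : ℝ, 0 < R ∧ ∀ x, h x ≠ 0 → ‖x‖ ≤ R := by
    obtain ⟨R, hR⟩ := hs.isBounded.subset_closedBall 0
    refine ⟨max R 1, by positivity, fun x hx => ?_⟩
    have := hR (subset_tsupport _ hx)
    rw [mem_closedBall_zero_iff] at this
    exact this.trans (le_max_left _ _)
  -- Where `h(δy) ≠ 0` and `δ < 1`, the radius satisfies `δ√(|y|² + 1) ≤ δ|y| + δ ≤ R + 1`.
  obtain ⟨C, hC0, hC⟩ := exists_norm_radialFlux_le hn k (R + 1)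
  obtain ⟨H, hH⟩ := hs.exists_bound_of_continuous hc
  have hscale : ∀ δ : ℝ, 0 < δ → ∫ x, ((δ ^ 2 / √(‖x‖ ^ 2 + δ ^ 2) ^ (n + 2) : ℝ) : ℂ) *
        radialFlux n k √(‖x‖ ^ 2 + δ ^ 2) * h x =
      ∫ y : EuclideanSpace ℝ (Fin n), ((1 / √(‖y‖ ^ 2 + 1) ^ (n + 2) : ℝ) : ℂ) *
        (radialFlux n k (δ * √(‖y‖ ^ 2 + 1)) * h (δ • y)) := by
    intro δ hδ
    have h1 := Measure.integral_comp_smul volume (fun x : EuclideanSpace ℝ (Fin n) =>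
      ((δ ^ 2 / √(‖x‖ ^ 2 + δ ^ 2) ^ (n + 2) : ℝ) : ℂ) *
        radialFlux n k √(‖x‖ ^ 2 + δ ^ 2) * h x) δ
    rw [finrank_euclideanSpace_fin, abs_of_pos (by positivity), eq_inv_smul_iff₀ (by positivity),
      Complex.real_smul, ← integral_const_mul] at h1
    rw [← h1]
    congr 1
    ext y
    have e : √(‖δ • y‖ ^ 2 + δ ^ 2) = δ * √(‖y‖ ^ 2 + 1) := by
      rw [norm_smul, Real.norm_of_nonneg hδ.le, mul_pow, ← mul_add_one, Real.sqrt_mul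
        (by positivity), Real.sqrt_sq hδ.le]
    rw [e, ← mul_assoc, ← mul_assoc, ← mul_assoc, ← Complex.ofReal_mul]
    congr 3
    have : 0 < √(‖y‖ ^ 2 + 1) := by positivity
    rw [mul_pow, pow_add]
    field_simp
  set m₀ : ℂ := n * -((Real.Gamma (n / 2) / (2 * Real.pi ^ ((n : ℝ) / 2)) : ℝ) : ℂ) with hm₀
  have hlim : Tendsto (fun δ : ℝ => ∫ y : EuclideanSpace ℝ (Fin n),
        ((1 / √(‖y‖ ^ 2 + 1) ^ (n + 2) : ℝ) : ℂ) *
        (radialFlux n k (δ * √(‖y‖ ^ 2 + 1)) * h (δ • y))) (𝓝[>] 0)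
      (𝓝 (∫ y : EuclideanSpace ℝ (Fin n), ((1 / √(‖y‖ ^ 2 + 1) ^ (n + 2) : ℝ) : ℂ) *
        (m₀ * h 0))) := by
    refine tendsto_integral_filter_of_dominated_convergence
      (fun y => 1 / √(‖y‖ ^ 2 + 1) ^ (n + 2) * (C * H)) ?_ ?_
      (integrable_one_div_sqrt_pow.mul_const _) ?_
    · filter_upwards [self_mem_nhdsWithin] with δ hδ
      have hδ : 0 < δ := hδ
      refine Continuous.aestronglyMeasurable ?_
      have h1 : Continuous fun y : EuclideanSpace ℝ (Fin n) =>
          radialFlux n k (δ * √(‖y‖ ^ 2 + 1)) :=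
        (continuousOn_radialFlux hn k).comp_continuous (by fun_prop) fun y => by
          have : 0 < √(‖y‖ ^ 2 + 1) := by positivity
          exact mul_pos hδ this
      have h2 : Continuous fun y : EuclideanSpace ℝ (Fin n) =>
          ((1 / √(‖y‖ ^ 2 + 1) ^ (n + 2) : ℝ) : ℂ) := by
        refine Complex.continuous_ofReal.comp (Continuous.div (by fun_prop) (by fun_prop) ?_)
        intro y
        positivity
      exact h2.mul (h1.mul (hc.comp (by fun_prop)))
    · filter_upwards [Ioo_mem_nhdsGT one_pos] with δ hδ
      refine Eventually.of_forall fun y => ?_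
      rw [norm_mul, Complex.norm_real, Real.norm_of_nonneg (by positivity), norm_mul]
      refine mul_le_mul_of_nonneg_left ?_ (by positivity)
      by_cases hy : h (δ • y) = 0
      · rw [hy, norm_zero, mul_zero]
        exact mul_nonneg hC0 ((norm_nonneg _).trans (hH 0))
      · have h1 := hR _ hy
        rw [norm_smul, Real.norm_of_nonneg hδ.1.le] at h1
        have h2 : √(‖y‖ ^ 2 + 1) ≤ ‖y‖ + 1 := by
          rw [Real.sqrt_le_left (by positivity)]
          nlinarith [norm_nonneg y]
        have h3 : 0 < √(‖y‖ ^ 2 + 1) := by positivity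
        gcongr
        · refine hC _ (mul_pos hδ.1 h3) ?_
          calc δ * √(‖y‖ ^ 2 + 1) ≤ δ * (‖y‖ + 1) := by
                have := hδ.1.le
                gcongr
            _ ≤ R + 1 := by
                have := hδ.2
                linarith
        · exact hH _
    · refine Eventually.of_forall fun y => ?_
      refine tendsto_const_nhds.mul (Tendsto.mul ?_ ?_)
      · have h3 : 0 < √(‖y‖ ^ 2 + 1) := by positivity
        refine (tendsto_radialFlux hn k).comp ?_
        refine tendsto_nhdsWithin_iff.mpr ⟨?_, ?_⟩
        · have : Continuous fun δ : ℝ => δ * √(‖y‖ ^ 2 + 1) := by fun_prop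
          have h := this.tendsto 0
          rw [zero_mul] at h
          exact h.mono_left nhdsWithin_le_nhds
        · filter_upwards [self_mem_nhdsWithin] with δ hδ
          exact mul_pos hδ h3
      · have : Continuous fun δ : ℝ => h (δ • y) := hc.comp (by fun_prop)
        have h := this.tendsto 0
        rw [zero_smul] at h
        exact h.mono_left nhdsWithin_le_nhds
  have hval : ∫ y : EuclideanSpace ℝ (Fin n), ((1 / √(‖y‖ ^ 2 + 1) ^ (n + 2) : ℝ) : ℂ) *
        (m₀ * h 0) = -h 0 := by
    rw [integral_mul_const, integral_complex_ofReal, integral_one_add_norm_sq hn, hm₀]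
    have hG : 0 < Real.Gamma ((n : ℝ) / 2) := Real.Gamma_pos_of_pos (by positivity)
    have hn0 : (n : ℝ) ≠ 0 := by positivity
    have hpi := Real.pi_pos
    have e : √Real.pi ^ n / Real.Gamma (n / 2 + 1) *
        (n * -(Real.Gamma (n / 2) / (2 * Real.pi ^ ((n : ℝ) / 2)))) = -1 := by
      have e1 : √Real.pi ^ n = Real.pi ^ ((n : ℝ) / 2) := by
        rw [Real.sqrt_eq_rpow, ← Real.rpow_natCast, ← Real.rpow_mul hpi.le]
        congr 1
        ring
      have : 0 < Real.pi ^ ((n : ℝ) / 2) := by positivity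
      rw [e1, Real.Gamma_add_one (by positivity)]
      field_simp
    have e' := congrArg (fun x : ℝ => (x : ℂ)) e
    push_cast at e' ⊢
    linear_combination h 0 * e'
  rw [hval] at hlim
  refine hlim.congr' ?_
  filter_upwards [self_mem_nhdsWithin] with δ hδ
  exact (hscale δ hδ).symm

theorem locallyIntegrable_norm_rpow (hn : 2 ≤ n) :
    LocallyIntegrable fun x : EuclideanSpace ℝ (Fin n) => ‖x‖ ^ (3 / 2 - n : ℝ) := by
  have : Nonempty (Fin n) := ⟨⟨0, by omega⟩⟩
  rw [locallyIntegrable_iff]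
  intro K hK
  obtain ⟨R, hR⟩ := hK.isBounded.subset_ball 0
  refine IntegrableOn.mono_set ?_ hR
  rw [integrableOn_fun_norm_addHaar (μ := volume) (f := fun r : ℝ => r ^ (3 / 2 - n : ℝ))]
  have hint : IntegrableOn (fun r : ℝ => r ^ (1 / 2 : ℝ)) (Set.Ioo 0 R) :=
    ((Real.continuous_rpow_const (by norm_num)).integrableOn_Icc
      (a := 0) (b := R)).mono_set Set.Ioo_subset_Icc_self
  refine hint.congr_fun (fun r hr => ?_) measurableSet_Ioo
  have hr0 : 0 < r := hr.1
  rw [finrank_euclideanSpace_fin, smul_eq_mul, ← Real.rpow_natCast, ← Real.rpow_add hr0,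
    Nat.cast_sub (by omega)]
  push_cast
  ring_nf

/-- The exponent `3/2 - n` is negative and regularising only enlarges the radius. Hence the locally
integrable function `|x|^{3/2 - n}` dominates for all small `δ`. -/
theorem tendsto_integral_regularised (hn : 2 ≤ n) (k : Wavenumber)
    {h : EuclideanSpace ℝ (Fin n) → ℂ} (hc : Continuous h) (hs : HasCompactSupport h) :
    Tendsto (fun δ : ℝ => ∫ x, radialSolution n k √(‖x‖ ^ 2 + δ ^ 2) * h x) (𝓝[>] 0)
      (𝓝 (∫ x, radialSolution n k ‖x‖ * h x)) := by
  have : Nonempty (Fin n) := ⟨⟨0, by omega⟩⟩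
  have : Nontrivial (EuclideanSpace ℝ (Fin n)) := inferInstance
  have hn' : (2 : ℝ) ≤ n := by exact_mod_cast hn
  obtain ⟨R, hR0, hR⟩ : ∃ R : ℝ, 0 < R ∧ ∀ x, h x ≠ 0 → ‖x‖ ≤ R := by
    obtain ⟨R, hR⟩ := hs.isBounded.subset_closedBall 0
    refine ⟨max R 1, by positivity, fun x hx => ?_⟩
    have := hR (subset_tsupport _ hx)
    rw [mem_closedBall_zero_iff] at this
    exact this.trans (le_max_left _ _)
  -- The regularised radius is at most `R + 1`; the bound is available on an open interval.
  obtain ⟨C, hC⟩ := norm_radialSolution_le hn k (R := R + 2) (by positivity)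
  have hne : ∀ᵐ x : EuclideanSpace ℝ (Fin n), x ≠ 0 := by
    simp [ae_iff]
  have hm := measurable_radialSolution n k
  have hb : Integrable fun x => ‖x‖ ^ (3 / 2 - n : ℝ) * (|C| * ‖h x‖) :=
    (locallyIntegrable_norm_rpow hn).integrable_smul_right_of_hasCompactSupport
      (by fun_prop) (hs.norm.mul_left)
  refine tendsto_integral_filter_of_dominated_convergence
    (fun x => ‖x‖ ^ (3 / 2 - n : ℝ) * (|C| * ‖h x‖)) ?_ ?_ hb ?_
  · refine Eventually.of_forall fun δ => ?_
    refine AEStronglyMeasurable.mul ?_ hc.aestronglyMeasurable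
    exact Measurable.aestronglyMeasurable (by fun_prop)
  · filter_upwards [Ioo_mem_nhdsGT one_pos] with δ hδ
    filter_upwards [hne] with x hx
    rw [norm_mul, ← mul_assoc]
    by_cases hhx : h x = 0
    · simp [hhx]
    have hx0 : 0 < ‖x‖ := norm_pos_iff.mpr hx
    have hxR := hR x hhx
    have h1 : ‖x‖ ≤ √(‖x‖ ^ 2 + δ ^ 2) := by
      refine Real.le_sqrt_of_sq_le ?_
      have := sq_nonneg δ
      linarith
    have h2 : √(‖x‖ ^ 2 + δ ^ 2) ≤ ‖x‖ + 1 := by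
      rw [Real.sqrt_le_left (by positivity)]
      nlinarith [hδ.1, hδ.2]
    gcongr
    calc ‖radialSolution n k √(‖x‖ ^ 2 + δ ^ 2)‖ ≤
          C * √(‖x‖ ^ 2 + δ ^ 2) ^ (3 / 2 - n : ℝ) :=
          hC _ ⟨hx0.trans_le h1, by linarith⟩
      _ ≤ |C| * ‖x‖ ^ (3 / 2 - n : ℝ) := by
          exact mul_le_mul (le_abs_self C) (Real.rpow_le_rpow_of_nonpos hx0 h1 (by linarith))
            (by positivity) (abs_nonneg C)
      _ = _ := mul_comm _ _
  · filter_upwards [hne] with x hx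
    have hx0 : 0 < ‖x‖ := norm_pos_iff.mpr hx
    refine Tendsto.mul_const _ ?_
    have h1 : Tendsto (fun δ : ℝ => √(‖x‖ ^ 2 + δ ^ 2)) (𝓝[>] 0) (𝓝 ‖x‖) := by
      have : Continuous fun δ : ℝ => √(‖x‖ ^ 2 + δ ^ 2) := by fun_prop
      have h := this.tendsto 0
      rw [zero_pow two_ne_zero, add_zero, Real.sqrt_sq hx0.le] at h
      exact h.mono_left nhdsWithin_le_nhds
    exact (hasDerivAt_radialSolution hn k hx0).continuousAt.tendsto.comp h1

/-- Translation moves the singularity to the origin, where both sides of the regularised identity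
have known limits. Assuming the identity for plain continuous `f` and `g` means that no translated
Schwartz functions are needed. -/
theorem integral_radialSolution_mul_eq_neg (hn : 2 ≤ n) (k : Wavenumber)
    (a : EuclideanSpace ℝ (Fin n)) {f g : EuclideanSpace ℝ (Fin n) → ℂ}
    (hf : Continuous f) (hfs : HasCompactSupport f) (hg : Continuous g)
    (hgs : HasCompactSupport g)
    (hfg : ∀ δ : ℝ, 0 < δ → ∫ x, radialSolution n k √(‖x - a‖ ^ 2 + δ ^ 2) * g x =
      ∫ x, ((δ ^ 2 / √(‖x - a‖ ^ 2 + δ ^ 2) ^ (n + 2) : ℝ) : ℂ) *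
        radialFlux n k √(‖x - a‖ ^ 2 + δ ^ 2) * f x) :
    ∫ x, radialSolution n k ‖x - a‖ * g x = -f a := by
  have ha : Continuous fun x : EuclideanSpace ℝ (Fin n) => x + a := by fun_prop
  have h1 := tendsto_integral_regularised hn k (hg.comp ha)
    (hgs.comp_homeomorph (Homeomorph.addRight a))
  have h2 := tendsto_integral_radialFlux hn k (hf.comp ha)
    (hfs.comp_homeomorph (Homeomorph.addRight a))
  have e0 := integral_add_right_eq_self (fun x => radialSolution n k ‖x - a‖ * g x) a
    (μ := volume)
  have h3 := tendsto_nhds_unique h1 (h2.congr' ?_)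
  · simp only [add_sub_cancel_right] at e0
    simp only [Function.comp_apply, zero_add] at h3
    rw [← e0, h3]
  filter_upwards [self_mem_nhdsWithin] with δ hδ
  have e1 := integral_add_right_eq_self
    (fun x => radialSolution n k √(‖x - a‖ ^ 2 + δ ^ 2) * g x) a (μ := volume)
  have e2 := integral_add_right_eq_self
    (fun x => ((δ ^ 2 / √(‖x - a‖ ^ 2 + δ ^ 2) ^ (n + 2) : ℝ) : ℂ) *
        radialFlux n k √(‖x - a‖ ^ 2 + δ ^ 2) * f x) a (μ := volume)
  simp only [add_sub_cancel_right] at e1 e2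
  simp only [Function.comp_apply]
  rw [e1, e2, hfg δ hδ]

/-- `G(|x - a|)` is a fundamental solution of the operator `-(Δ + k²)`. -/
theorem integral_radialSolution_mul_helmholtz (hn : 2 ≤ n) (k : Wavenumber)
    (a : EuclideanSpace ℝ (Fin n)) {f : 𝓢(EuclideanSpace ℝ (Fin n), ℂ)}
    (hf : HasCompactSupport f) :
    ∫ x, radialSolution n k ‖x - a‖ * (Δ f x + (k : ℂ) ^ 2 * f x) = -f a :=
  integral_radialSolution_mul_eq_neg hn k a f.continuous hf
    ((Δ f).continuous.add (continuous_const.mul f.continuous))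
    ((hasCompactSupport_laplacian hf).add hf.mul_left)
    fun _ hδ => integral_regularised_mul_helmholtz hn k hδ a hf

/-- This supplies sources whose potentials are known in closed form and compactly supported. -/
theorem newtonPotential_helmholtz (hn : 2 ≤ n) (k : Wavenumber)
    {f : 𝓢(EuclideanSpace ℝ (Fin n), ℂ)} (hf : HasCompactSupport f)
    (x : EuclideanSpace ℝ (Fin n)) :
    newtonPotential n k ⇑(-(Δ f + (k : ℂ) ^ 2 • f)) x = f x := by
  have h := integral_radialSolution_mul_helmholtz hn k x hf
  have : ∀ y, fundamentalSolution n k x y * (-(Δ f + (k : ℂ) ^ 2 • f)) y =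
      -(radialSolution n k ‖y - x‖ * (Δ f y + (k : ℂ) ^ 2 * f y)) := fun y => by
    rw [fundamentalSolution, norm_sub_rev]
    simp only [neg_apply, add_apply, smul_apply, smul_eq_mul]
    ring
  rw [newtonPotential]
  simp only [this]
  rw [integral_neg, h, neg_neg]

end FundamentalSolution

section

variable {n : ℕ} {k : Wavenumber} {s : ℝ}

/-! ### Schwartz functions in the Sobolev spaces -/

theorem weightedFourier_schwartz (f : 𝓢(EuclideanSpace ℝ (Fin n), ℂ)) :
    weightedFourier n k s (f : 𝓢'(EuclideanSpace ℝ (Fin n), ℂ)) =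
      (SchwartzMap.smulLeftCLM ℂ (weight n k s) (𝓕 f) : 𝓢(EuclideanSpace ℝ (Fin n), ℂ)) := by
  change TemperedDistribution.smulLeftCLM ℂ (weight n k s) (𝓕 _) = _
  rw [fourier_toTemperedDistributionCLM_eq]
  ext φ
  rw [TemperedDistribution.smulLeftCLM_apply_apply, SchwartzMap.coe_apply, SchwartzMap.coe_apply]
  congr 1
  ext x
  rw [SchwartzMap.smulLeftCLM_apply_apply (weight_hasTemperateGrowth n k s),
    SchwartzMap.smulLeftCLM_apply_apply (weight_hasTemperateGrowth n k s)]
  simp only [smul_eq_mul]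
  ring

theorem lTwoToTempered_toLp (f : 𝓢(EuclideanSpace ℝ (Fin n), ℂ)) :
    lTwoToTempered n (f.toLp 2) = (f : 𝓢'(EuclideanSpace ℝ (Fin n), ℂ)) :=
  Lp.toTemperedDistribution_toLp_eq f

theorem exists_toDistribution_eq (k : Wavenumber) (s : ℝ)
    (f : 𝓢(EuclideanSpace ℝ (Fin n), ℂ)) :
    ∃ u : SobolevSpace n k s, u.toDistribution = (f : 𝓢'(EuclideanSpace ℝ (Fin n), ℂ)) :=
  ⟨(⟨f, ⟨_, (lTwoToTempered_toLp _).trans (weightedFourier_schwartz f).symm⟩⟩ :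
    ↥(sobolevSubmodule n k s)), rfl⟩

theorem symbol_of_toDistribution_eq {u : SobolevSpace n k s}
    {f : 𝓢(EuclideanSpace ℝ (Fin n), ℂ)}
    (hu : u.toDistribution = (f : 𝓢'(EuclideanSpace ℝ (Fin n), ℂ))) :
    u.symbol = (SchwartzMap.smulLeftCLM ℂ (weight n k s) (𝓕 f)).toLp 2 := by
  apply lTwoToTempered_injective n
  rw [SobolevSpace.lTwoToTempered_symbol, hu, weightedFourier_schwartz, lTwoToTempered_toLp]

theorem fourier_laplacian_apply (f : 𝓢(EuclideanSpace ℝ (Fin n), ℂ))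
    (ζ : EuclideanSpace ℝ (Fin n)) :
    𝓕 (Δ f) ζ = -((2 * Real.pi * ‖ζ‖) ^ 2 : ℝ) * 𝓕 f ζ := by
  have h : (fun x : EuclideanSpace ℝ (Fin n) => ‖x‖ ^ 2).HasTemperateGrowth :=
    Function.hasTemperateGrowth_norm_sq _
  rw [SchwartzMap.laplacian_eq_fourierMultiplierCLM, FourierTransform.fourier_smul,
    SchwartzMap.fourierMultiplierCLM_apply, FourierTransform.fourier_fourierInv_eq, smul_apply,
    SchwartzMap.smulLeftCLM_apply_apply h, Complex.real_smul, Complex.real_smul]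
  push_cast
  ring

/-- The Helmholtz operator `k² - Δ` whose symbol is the square of the weight of `H^1_k(ℝⁿ)`. -/
theorem weight_mul_weight_mul_fourier (k : Wavenumber) (f : 𝓢(EuclideanSpace ℝ (Fin n), ℂ))
    (ζ : EuclideanSpace ℝ (Fin n)) :
    (starRingEnd ℂ) (weight n k 1 ζ) * (weight n k 1 ζ * 𝓕 f ζ) =
      𝓕 ((k : ℂ) ^ 2 • f - Δ f) ζ := by
  have hb := weight_base_pos k ‖ζ‖
  have e : ((((k : ℝ) ^ 2 + (2 * Real.pi * ‖ζ‖) ^ 2) ^ ((1 : ℝ) / 2) : ℝ) : ℂ) *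
      ((((k : ℝ) ^ 2 + (2 * Real.pi * ‖ζ‖) ^ 2) ^ ((1 : ℝ) / 2) : ℝ) : ℂ) =
      (((k : ℝ) ^ 2 + (2 * Real.pi * ‖ζ‖) ^ 2 : ℝ) : ℂ) := by
    rw [← Complex.ofReal_mul, ← Real.rpow_add hb]
    norm_num
  rw [sub_eq_add_neg, FourierAdd.fourier_add, FourierTransform.fourier_neg,
    FourierTransform.fourier_smul, add_apply, neg_apply, smul_apply, fourier_laplacian_apply,
    weight, Complex.conj_ofReal, ← mul_assoc, e, smul_eq_mul]
  push_cast
  ring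

/-- By Plancherel, the squared weight becomes the differential operator `k² - Δ`. The point is
locality: disjoint supports give orthogonality. -/
theorem inner_eq_integral {u v : SobolevSpace n k 1} {φ f : 𝓢(EuclideanSpace ℝ (Fin n), ℂ)}
    (hu : u.toDistribution = (φ : 𝓢'(EuclideanSpace ℝ (Fin n), ℂ)))
    (hv : v.toDistribution = (f : 𝓢'(EuclideanSpace ℝ (Fin n), ℂ))) :
    inner ℂ u v = ∫ x, inner ℂ (φ x) (((k : ℂ) ^ 2 • f - Δ f) x) := by
  change inner ℂ u.symbol v.symbol = _
  have hi := fun g h : 𝓢(EuclideanSpace ℝ (Fin n), ℂ) => SchwartzMap.inner_toL2_toL2_eq g h volume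
  rw [symbol_of_toDistribution_eq hu, symbol_of_toDistribution_eq hv,
    hi, ← hi φ, ← Lp.inner_fourier_eq, SchwartzMap.toLp_fourier_eq, SchwartzMap.toLp_fourier_eq,
    hi]
  congr 1
  ext ζ
  rw [← weight_mul_weight_mul_fourier,
    SchwartzMap.smulLeftCLM_apply_apply (weight_hasTemperateGrowth n k 1),
    SchwartzMap.smulLeftCLM_apply_apply (weight_hasTemperateGrowth n k 1)]
  simp only [RCLike.inner_apply, smul_eq_mul, map_mul]
  ring

theorem norm_toLp_le_of_norm_le {f g : 𝓢(EuclideanSpace ℝ (Fin n), ℂ)} {c : ℝ}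
    (h : ∀ x, ‖f x‖ ≤ c * ‖g x‖) : ‖f.toLp 2‖ ≤ c * ‖g.toLp 2‖ := by
  refine Lp.norm_le_mul_norm_of_ae_le_mul ?_
  filter_upwards [f.coeFn_toLp 2, g.coeFn_toLp 2] with x hf hg
  rw [hf, hg]
  exact h x

theorem norm_toLp_fourier (f : 𝓢(EuclideanSpace ℝ (Fin n), ℂ)) :
    ‖(𝓕 f).toLp 2‖ = ‖f.toLp 2‖ := by
  rw [← SchwartzMap.toLp_fourier_eq, Lp.norm_fourier_eq]

theorem norm_weight (k : Wavenumber) (s : ℝ) (ζ : EuclideanSpace ℝ (Fin n)) :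
    ‖weight n k s ζ‖ = ((k : ℝ) ^ 2 + (2 * Real.pi * ‖ζ‖) ^ 2) ^ (s / 2) := by
  have hb := weight_base_pos k ‖ζ‖
  rw [weight, Complex.norm_real, Real.norm_of_nonneg (by positivity)]

theorem le_norm_weight_one (k : Wavenumber) (ζ : EuclideanSpace ℝ (Fin n)) :
    (k : ℝ) ≤ ‖weight n k 1 ζ‖ := by
  rw [norm_weight, ← Real.sqrt_eq_rpow]
  refine Real.le_sqrt_of_sq_le ?_
  have := sq_nonneg (2 * Real.pi * ‖ζ‖)
  linarith

theorem norm_weight_neg_one_le (k : Wavenumber) (ζ : EuclideanSpace ℝ (Fin n)) :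
    ‖weight n k (-1) ζ‖ ≤ (k : ℝ)⁻¹ := by
  have h := congrFun (weight_mul_neg n k 1) ζ
  have hk := k.2
  have h1 := le_norm_weight_one (n := n) k ζ
  have h2 := congrArg norm h
  rw [Pi.mul_apply, norm_mul, norm_one] at h2
  rw [eq_inv_of_mul_eq_one_right h2]
  exact inv_anti₀ hk h1

theorem mul_norm_toLp_le {u : SobolevSpace n k 1} {f : 𝓢(EuclideanSpace ℝ (Fin n), ℂ)}
    (hu : u.toDistribution = (f : 𝓢'(EuclideanSpace ℝ (Fin n), ℂ))) :
    (k : ℝ) * ‖f.toLp 2‖ ≤ ‖u‖ := by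
  have hk := k.2
  rw [SobolevSpace.norm_eq, symbol_of_toDistribution_eq hu, ← norm_toLp_fourier f,
    ← le_inv_mul_iff₀ hk]
  refine norm_toLp_le_of_norm_le fun ζ => ?_
  rw [SchwartzMap.smulLeftCLM_apply_apply (weight_hasTemperateGrowth n k 1), norm_smul,
    le_inv_mul_iff₀ hk]
  gcongr
  exact le_norm_weight_one k ζ

theorem norm_le_inv_mul_norm_toLp {u : SobolevSpace n k (-1)}
    {f : 𝓢(EuclideanSpace ℝ (Fin n), ℂ)}
    (hu : u.toDistribution = (f : 𝓢'(EuclideanSpace ℝ (Fin n), ℂ))) :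
    ‖u‖ ≤ (k : ℝ)⁻¹ * ‖f.toLp 2‖ := by
  rw [SobolevSpace.norm_eq, symbol_of_toDistribution_eq hu, ← norm_toLp_fourier f]
  refine norm_toLp_le_of_norm_le fun ζ => ?_
  rw [SchwartzMap.smulLeftCLM_apply_apply (weight_hasTemperateGrowth n k (-1)), norm_smul]
  gcongr
  exact norm_weight_neg_one_le k ζ

/-! ### Supports -/

theorem mem_supportedIn {u : SobolevSpace n k s} {f : 𝓢(EuclideanSpace ℝ (Fin n), ℂ)}
    (hu : u.toDistribution = (f : 𝓢'(EuclideanSpace ℝ (Fin n), ℂ)))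
    {F : Set (EuclideanSpace ℝ (Fin n))} (hF : IsClosed F) (hf : tsupport f ⊆ F) :
    u ∈ supportedIn n k s F := by
  change Distribution.dsupport u.toDistribution ⊆ F
  refine Set.sInter_subset_of_mem ⟨fun φ hφ => ?_, hF⟩
  rw [hu, SchwartzMap.coe_apply]
  refine integral_eq_zero_of_ae (Eventually.of_forall fun x => ?_)
  by_cases hx : x ∈ tsupport f
  · have : x ∉ tsupport φ := fun h => hφ h (hf hx)
    simp [image_eq_zero_of_notMem_tsupport this]
  · simp [image_eq_zero_of_notMem_tsupport hx]

/-- It suffices to test against smooth functions supported off `Γ`, and `(k² - Δ) f` vanishes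
outside the support of `f`. Consequently `P_k` fixes `v`. -/
theorem mem_orthogonal_tildeSpace {v : SobolevSpace n k 1}
    {f : 𝓢(EuclideanSpace ℝ (Fin n), ℂ)}
    (hv : v.toDistribution = (f : 𝓢'(EuclideanSpace ℝ (Fin n), ℂ)))
    {Γ : Set (EuclideanSpace ℝ (Fin n))} (hf : tsupport f ⊆ Γ) :
    v ∈ (tildeSpace n k 1 Γᶜ)ᗮ := by
  rw [tildeSpace, Submodule.orthogonal_closure]
  rw [Submodule.mem_orthogonal]
  rintro u ⟨φ, -, hφ, hu⟩
  rw [inner_eq_integral hu hv]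
  refine integral_eq_zero_of_ae (Eventually.of_forall fun x => ?_)
  by_cases hx : x ∈ tsupport f
  · have : x ∉ tsupport φ := fun h => hφ h (hf hx)
    simp [image_eq_zero_of_notMem_tsupport this]
  · have hΔ : Δ f x = 0 :=
      image_eq_zero_of_notMem_tsupport fun h => hx (tsupport_laplacian_subset f h)
    simp [image_eq_zero_of_notMem_tsupport hx, hΔ]

/-! ### Symmetry of the Newtonian potential -/

/-- Fubini and the symmetry of the kernel; only joint integrability needs an argument. -/
theorem integral_newtonPotential_mul (hn : 2 ≤ n) (k : Wavenumber)
    {f g : EuclideanSpace ℝ (Fin n) → ℂ} (hf : Continuous f) (hfs : HasCompactSupport f)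
    (hg : Continuous g) (hgs : HasCompactSupport g) :
    ∫ x, newtonPotential n k f x * g x = ∫ x, f x * newtonPotential n k g x := by
  obtain ⟨R, hR⟩ := (hfs.isCompact.union hgs.isCompact).isBounded.subset_closedBall 0
  have hRf : ∀ x, f x ≠ 0 → ‖x‖ ≤ R := fun x hx => by
    simpa using hR (Or.inl (subset_tsupport _ hx))
  have hRg : ∀ x, g x ≠ 0 → ‖x‖ ≤ R := fun x hx => by
    simpa using hR (Or.inr (subset_tsupport _ hx))
  -- Both supports lie in the ball of radius `R`, so only `|x - y| ≤ 2R` matters. The truncated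
  -- kernel is integrable on the whole space.
  set G : EuclideanSpace ℝ (Fin n) → ℂ :=
    (Metric.closedBall 0 (2 * R)).indicator fun z => radialSolution n k ‖z‖ with hG
  have hGi : Integrable G :=
    ((locallyIntegrable_radialSolution hn k).integrableOn_isCompact
      (isCompact_closedBall 0 (2 * R))).integrable_indicator Metric.isClosed_closedBall.measurableSet
  have h1 : Integrable (fun p : EuclideanSpace ℝ (Fin n) × EuclideanSpace ℝ (Fin n) =>
      f p.2 * G (p.1 - p.2)) (volume.prod volume) :=
    (hf.integrable_of_hasCompactSupport hfs).convolution_integrand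
      (ContinuousLinearMap.mul ℝ ℂ) hGi
  obtain ⟨C, hC⟩ := hgs.exists_bound_of_continuous hg
  have h2 : Integrable (fun p : EuclideanSpace ℝ (Fin n) × EuclideanSpace ℝ (Fin n) =>
      f p.2 * G (p.1 - p.2) * g p.1) (volume.prod volume) :=
    h1.mul_bdd (c := C) (hg.comp continuous_fst).aestronglyMeasurable
      (Eventually.of_forall fun p => hC p.1)
  have h3 : Integrable (Function.uncurry fun x y : EuclideanSpace ℝ (Fin n) =>
      fundamentalSolution n k x y * f y * g x) (volume.prod volume) := by
    refine h2.congr (Eventually.of_forall fun ⟨x, y⟩ => ?_)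
    simp only [Function.uncurry_apply_pair, fundamentalSolution]
    by_cases hx : g x = 0
    · simp [hx]
    by_cases hy : f y = 0
    · simp [hy]
    have : x - y ∈ Metric.closedBall (0 : EuclideanSpace ℝ (Fin n)) (2 * R) := by
      rw [mem_closedBall_zero_iff]
      have := norm_sub_le x y
      have := hRf y hy
      have := hRg x hx
      linarith
    rw [hG, Set.indicator_of_mem this]
    ring
  calc ∫ x, newtonPotential n k f x * g x =
        ∫ x, ∫ y, fundamentalSolution n k x y * f y * g x := by
        simp only [newtonPotential, ← integral_mul_const]
    _ = ∫ y, ∫ x, fundamentalSolution n k x y * f y * g x := integral_integral_swap h3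
    _ = ∫ y, f y * newtonPotential n k g y := by
        simp only [newtonPotential, ← integral_const_mul]
        congr 1
        ext y
        congr 1
        ext x
        rw [fundamentalSolution, fundamentalSolution, norm_sub_rev]
        ring

/-- The transposed definition reduces to the symmetry of the Newtonian potential, applied to a
source whose potential is `f`. The cutoff disappears since `χ = 1` on the support of `f`. -/
theorem isCutoffPotential_of_helmholtz (hn : 2 ≤ n) (k : Wavenumber)
    {Γ : Set (EuclideanSpace ℝ (Fin n))} {χ : EuclideanSpace ℝ (Fin n) → ℂ} (hχ : IsCutoff Γ χ)
    {f : 𝓢(EuclideanSpace ℝ (Fin n), ℂ)} (hf : HasCompactSupport f) (hfΓ : tsupport f ⊆ Γ) :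
    IsCutoffPotential hn k hχ ((-(Δ f + (k : ℂ) ^ 2 • f) :
      𝓢(EuclideanSpace ℝ (Fin n), ℂ)) : 𝓢'(EuclideanSpace ℝ (Fin n), ℂ))
      (f : 𝓢'(EuclideanSpace ℝ (Fin n), ℂ)) := by
  intro φ
  have hχ1 : ∀ x ∈ tsupport f, χ x = 1 := fun x hx =>
    hχ.eventually_eq_one.self_of_nhdsSet x (hfΓ hx)
  set g : 𝓢(EuclideanSpace ℝ (Fin n), ℂ) := -(Δ f + (k : ℂ) ^ 2 • f) with hg
  have hg0 : ∀ x, x ∉ tsupport f → g x = 0 := fun x hx => by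
    have hΔ : Δ f x = 0 :=
      image_eq_zero_of_notMem_tsupport fun h => hx (tsupport_laplacian_subset f h)
    simp [hg, image_eq_zero_of_notMem_tsupport hx, hΔ]
  have hgs : HasCompactSupport g := HasCompactSupport.intro hf hg0
  have hs := integral_newtonPotential_mul hn k (f := g) (g := fun x => χ x * φ x) g.continuous hgs
    (hχ.contDiff.continuous.mul φ.continuous) hχ.hasCompactSupport.mul_right
  have hN : ∀ x, newtonPotential n k g x = f x := newtonPotential_helmholtz hn k hf
  simp only [hN] at hs
  rw [SchwartzMap.coe_apply, SchwartzMap.coe_apply]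
  calc ∫ x, φ x • f x = ∫ x, f x * (χ x * φ x) := by
        congr 1
        ext x
        by_cases hx : x ∈ tsupport f
        · rw [hχ1 x hx, smul_eq_mul]; ring
        · simp [image_eq_zero_of_notMem_tsupport hx]
    _ = _ := hs
    _ = _ := by
        congr 1
        ext x
        change _ = (χ x * newtonPotential n k (fun y => χ y * φ y) x) • g x
        by_cases hx : x ∈ tsupport f
        · rw [hχ1 x hx, smul_eq_mul]; ring
        · simp [hg0 x hx]

theorem operatorA_eq (hn : 2 ≤ n) (k : Wavenumber) {Γ : Set (EuclideanSpace ℝ (Fin n))}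
    {χ : EuclideanSpace ℝ (Fin n) → ℂ} (hχ : IsCutoff Γ χ) {ψ : ↥(supportedIn n k (-1) Γ)}
    {v : SobolevSpace n k 1}
    (hv : IsCutoffPotential hn k hχ (SobolevSpace.toDistribution ψ.1) v.toDistribution) :
    operatorA hn k hχ ψ = projection n k Γ v := by
  have h : ∃ v : SobolevSpace n k 1,
      IsCutoffPotential hn k hχ (SobolevSpace.toDistribution ψ.1) v.toDistribution := ⟨v, hv⟩
  rw [operatorA, dif_pos h, h.choose_spec.unique hv]

end

section

variable {n : ℕ} {k : Wavenumber}

/-! ### Modulation by plane waves -/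

theorem hasTemperateGrowth_cexp_mul_I :
    (fun t : ℝ => Complex.exp (t * Complex.I)).HasTemperateGrowth := by
  have hd : ∀ (c : ℂ) (t : ℝ), HasDerivAt (fun t : ℝ => c * Complex.exp (t * Complex.I))
      (c * Complex.I * Complex.exp (t * Complex.I)) t := by
    intro c t
    have h := (((Complex.ofRealCLM.hasDerivAt (x := t)).mul_const Complex.I).cexp).const_mul c
    refine HasDerivAt.congr_deriv h ?_
    simp only [Complex.ofRealCLM_apply, Complex.ofReal_one, one_mul]
    ring
  have hi : ∀ m : ℕ, iteratedDeriv m (fun t : ℝ => Complex.exp (t * Complex.I)) =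
      fun t : ℝ => Complex.I ^ m * Complex.exp (t * Complex.I) := by
    intro m
    induction m with
    | zero => simp
    | succ m ih =>
      rw [iteratedDeriv_succ, ih]
      ext t
      rw [(hd (Complex.I ^ m) t).deriv, pow_succ]
  refine ⟨?_, fun m => ⟨0, 1, fun t => ?_⟩⟩
  · exact (Complex.ofRealCLM.contDiff.mul contDiff_const).cexp
  · rw [norm_iteratedFDeriv_eq_norm_iteratedDeriv, hi]
    simp [Complex.norm_exp_ofReal_mul_I]

/-- The plane wave `e^{iκ⟨d, x⟩}`. -/
def planeWave (κ : ℝ) (d x : EuclideanSpace ℝ (Fin n)) : ℂ :=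
  Complex.exp (((κ * inner ℝ d x : ℝ) : ℂ) * Complex.I)

theorem planeWave_hasTemperateGrowth (κ : ℝ) (d : EuclideanSpace ℝ (Fin n)) :
    (planeWave κ d).HasTemperateGrowth := by
  have h : (fun x : EuclideanSpace ℝ (Fin n) => κ * inner ℝ d x).HasTemperateGrowth := by
    fun_prop
  exact hasTemperateGrowth_cexp_mul_I.comp h

theorem norm_planeWave (κ : ℝ) (d x : EuclideanSpace ℝ (Fin n)) : ‖planeWave κ d x‖ = 1 :=
  Complex.norm_exp_ofReal_mul_I _

/-- Multiplication of a Schwartz function by a plane wave. -/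
def modulate (κ : ℝ) (d : EuclideanSpace ℝ (Fin n)) :
    𝓢(EuclideanSpace ℝ (Fin n), ℂ) →L[ℂ] 𝓢(EuclideanSpace ℝ (Fin n), ℂ) :=
  SchwartzMap.smulLeftCLM ℂ (planeWave κ d)

theorem modulate_apply (κ : ℝ) (d : EuclideanSpace ℝ (Fin n))
    (g : 𝓢(EuclideanSpace ℝ (Fin n), ℂ)) (x : EuclideanSpace ℝ (Fin n)) :
    modulate κ d g x = planeWave κ d x * g x :=
  SchwartzMap.smulLeftCLM_apply_apply (planeWave_hasTemperateGrowth κ d) g x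

theorem norm_toLp_modulate (κ : ℝ) (d : EuclideanSpace ℝ (Fin n))
    (g : 𝓢(EuclideanSpace ℝ (Fin n), ℂ)) : ‖(modulate κ d g).toLp 2‖ = ‖g.toLp 2‖ := by
  have h : ∀ x, ‖modulate κ d g x‖ = ‖g x‖ := fun x => by
    rw [modulate_apply, norm_mul, norm_planeWave, one_mul]
  apply le_antisymm
  · simpa using norm_toLp_le_of_norm_le (c := 1) fun x => by rw [h, one_mul]
  · simpa using norm_toLp_le_of_norm_le (c := 1) fun x => by rw [h, one_mul]

theorem hasFDerivAt_planeWave (κ : ℝ) (d x : EuclideanSpace ℝ (Fin n)) :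
    HasFDerivAt (planeWave κ d)
      ((planeWave κ d x * Complex.I) • (Complex.ofRealCLM ∘L (κ • innerSL ℝ d))) x := by
  have h1 : HasFDerivAt (fun x : EuclideanSpace ℝ (Fin n) => ((κ * inner ℝ d x : ℝ) : ℂ))
      (Complex.ofRealCLM ∘L (κ • innerSL ℝ d)) x :=
    Complex.ofRealCLM.hasFDerivAt.comp x (((innerSL ℝ d).hasFDerivAt).const_mul κ)
  refine (h1.mul_const Complex.I).cexp.congr_fderiv ?_
  rw [smul_smul, planeWave]

theorem lineDerivOp_modulate (κ : ℝ) (d v : EuclideanSpace ℝ (Fin n))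
    (g : 𝓢(EuclideanSpace ℝ (Fin n), ℂ)) :
    ∂_{v} (modulate κ d g) =
      modulate κ d (∂_{v} g) + ((κ * inner ℝ d v : ℝ) * Complex.I : ℂ) • modulate κ d g := by
  ext x
  have h : ⇑(modulate κ d g) = planeWave κ d * ⇑g := by
    ext x
    exact modulate_apply κ d g x
  have hd := (hasFDerivAt_planeWave κ d x).mul (g.differentiableAt.hasFDerivAt (x := x))
  rw [SchwartzMap.lineDerivOp_apply_eq_fderiv, h, hd.fderiv, add_apply, add_apply, modulate_apply,
    SchwartzMap.lineDerivOp_apply_eq_fderiv]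
  simp only [smul_apply, smul_eq_mul, modulate_apply, ContinuousLinearMap.comp_apply,
    Complex.ofRealCLM_apply, innerSL_apply_apply]
  ring

/-- The derivative in the direction `d`. -/
def directionalDeriv (d : EuclideanSpace ℝ (Fin n)) (g : 𝓢(EuclideanSpace ℝ (Fin n), ℂ)) :
    𝓢(EuclideanSpace ℝ (Fin n), ℂ) :=
  ∑ i, ((inner ℝ d (EuclideanSpace.basisFun (Fin n) ℝ i) : ℝ) : ℂ) •
    ∂_{EuclideanSpace.basisFun (Fin n) ℝ i} g

/-- For `|d| = 1` the plane wave is annihilated by `Δ + κ²`, so no `κ²` term remains; the cross term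
of the product rule is linear in `κ`. This cancellation gives the growth in `k`. -/
theorem helmholtz_modulate (κ : ℝ) {d : EuclideanSpace ℝ (Fin n)} (hd : ‖d‖ = 1)
    (g : 𝓢(EuclideanSpace ℝ (Fin n), ℂ)) :
    -(Δ (modulate κ d g) + (κ : ℂ) ^ 2 • modulate κ d g) =
      -(modulate κ d (Δ g) +
        (2 * κ * Complex.I : ℂ) • modulate κ d (directionalDeriv d g)) := by
  set b := EuclideanSpace.basisFun (Fin n) ℝ with hb
  have hsum : ∑ i, ((inner ℝ d (b i) : ℝ) : ℂ) ^ 2 = 1 := by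
    have := b.sum_sq_inner_left d
    rw [hd] at this
    exact_mod_cast this.trans (by norm_num)
  congr 1
  rw [SchwartzMap.laplacian_eq_sum b, SchwartzMap.laplacian_eq_sum b, directionalDeriv, map_sum,
    map_sum]
  ext x
  simp only [add_apply, smul_apply, sum_apply, lineDerivOp_modulate, map_smul, smul_eq_mul,
    LineDeriv.lineDerivOp_add, LineDeriv.lineDerivOp_smul, ← hb]
  rw [Finset.mul_sum, ← Finset.sum_add_distrib]
  have e : (κ : ℂ) ^ 2 * modulate κ d g x =
      ∑ i, (κ : ℂ) ^ 2 * ((inner ℝ d (b i) : ℝ) : ℂ) ^ 2 * modulate κ d g x := by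
    rw [← Finset.sum_mul, ← Finset.mul_sum, hsum, mul_one]
  rw [e, ← Finset.sum_add_distrib]
  refine Finset.sum_congr rfl fun i _ => ?_
  push_cast
  ring_nf
  rw [Complex.I_sq]
  ring

theorem norm_toLp_helmholtz_modulate_le {κ : ℝ} (hκ : 0 ≤ κ) {d : EuclideanSpace ℝ (Fin n)}
    (hd : ‖d‖ = 1) (g : 𝓢(EuclideanSpace ℝ (Fin n), ℂ)) :
    ‖(-(Δ (modulate κ d g) + (κ : ℂ) ^ 2 • modulate κ d g)).toLp 2‖ ≤
      ‖(Δ g).toLp 2‖ + 2 * κ * ‖(directionalDeriv d g).toLp 2‖ := by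
  have hadd : ∀ f h : 𝓢(EuclideanSpace ℝ (Fin n), ℂ), (f + h).toLp 2 volume = f.toLp 2 volume + h.toLp 2 volume :=
    fun f h => map_add (SchwartzMap.toLpCLM ℂ ℂ 2 volume) f h
  have hneg : ∀ f : 𝓢(EuclideanSpace ℝ (Fin n), ℂ), (-f).toLp 2 volume = -f.toLp 2 volume :=
    fun f => map_neg (SchwartzMap.toLpCLM ℂ ℂ 2 volume) f
  have hsmul : ∀ (c : ℂ) (f : 𝓢(EuclideanSpace ℝ (Fin n), ℂ)), (c • f).toLp 2 volume = c • f.toLp 2 volume :=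
    fun c f => map_smul (SchwartzMap.toLpCLM ℂ ℂ 2 volume) c f
  rw [helmholtz_modulate κ hd, hneg, hadd, hsmul, norm_neg]
  refine (norm_add_le _ _).trans ?_
  rw [norm_smul, norm_toLp_modulate, norm_toLp_modulate]
  simp [abs_of_nonneg hκ]

/-! ### The lower bound -/

theorem norm_orthogonalProjectionOnto_of_mem {E : Type*} [NormedAddCommGroup E]
    [InnerProductSpace ℂ E] (K : Submodule ℂ E) [K.HasOrthogonalProjection] {v : E} (hv : v ∈ K) :
    ‖K.orthogonalProjectionOnto v‖ = ‖v‖ :=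
  congrArg norm (K.orthogonalProjectionOnto_mem_subspace_eq_self ⟨v, hv⟩)

theorem norm_projection_eq {k : Wavenumber} {Γ : Set (EuclideanSpace ℝ (Fin n))}
    {v : SobolevSpace n k 1} (hv : v ∈ (tildeSpace n k 1 Γᶜ)ᗮ) :
    ‖projection n k Γ v‖ = ‖v‖ :=
  norm_orthogonalProjectionOnto_of_mem _ hv

theorem div_le_operatorNormA (hn : 2 ≤ n) (k : Wavenumber) {Γ : Set (EuclideanSpace ℝ (Fin n))}
    {χ : EuclideanSpace ℝ (Fin n) → ℂ} (hχ : IsCutoff Γ χ) {ψ : ↥(supportedIn n k (-1) Γ)}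
    {v : SobolevSpace n k 1} (hv : v ∈ (tildeSpace n k 1 Γᶜ)ᗮ) (hv0 : v ≠ 0)
    (hpot : IsCutoffPotential hn k hχ (SobolevSpace.toDistribution ψ.1) v.toDistribution) :
    (ψ : SobolevSpace n k (-1)) ≠ 0 ∧
      ENNReal.ofReal (‖v‖ / ‖(ψ : SobolevSpace n k (-1))‖) ≤ operatorNormA hn k hχ := by
  have hψ0 : (ψ : SobolevSpace n k (-1)) ≠ 0 := by
    -- If the source were zero, then 0 would also be its cutoff potential, and uniqueness would
    -- force `v = 0`.
    intro h
    refine hv0 (hpot.unique fun φ => ?_)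
    have e0 : SobolevSpace.toDistribution (0 : SobolevSpace n k 1) = 0 := rfl
    have e1 : SobolevSpace.toDistribution (0 : SobolevSpace n k (-1)) = 0 := rfl
    rw [h, e0, e1]
    rfl
  refine ⟨hψ0, ?_⟩
  have h := le_iSup₂ (f := fun (ψ : ↥(supportedIn n k (-1) Γ))
    (_ : (ψ : SobolevSpace n k (-1)) ≠ 0) =>
      ‖operatorA hn k hχ ψ‖ₑ / ‖(ψ : SobolevSpace n k (-1))‖ₑ) ψ hψ0
  refine le_trans (le_of_eq ?_) h
  rw [operatorA_eq hn k hχ hpot, ENNReal.ofReal_div_of_pos (norm_pos_iff.mpr hψ0),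
    ← ofReal_norm, ← ofReal_norm, norm_projection_eq hv]

theorem tsupport_helmholtz_subset (k : Wavenumber) (f : 𝓢(EuclideanSpace ℝ (Fin n), ℂ)) :
    tsupport ⇑(-(Δ f + (k : ℂ) ^ 2 • f)) ⊆ tsupport f := by
  refine closure_minimal (fun x hx => ?_) (isClosed_tsupport f)
  contrapose! hx
  have hΔ : Δ f x = 0 :=
    image_eq_zero_of_notMem_tsupport fun h => hx (tsupport_laplacian_subset f h)
  simp [image_eq_zero_of_notMem_tsupport hx, hΔ]

/-- The `H^1_k` norm of the potential and the `H^{-1}_k` norm of the source each contribute one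
factor `k` when compared with `L²`. -/
theorem le_operatorNormA (hn : 2 ≤ n) (k : Wavenumber) {Γ : Set (EuclideanSpace ℝ (Fin n))}
    (hΓ : IsClosed Γ) {χ : EuclideanSpace ℝ (Fin n) → ℂ} (hχ : IsCutoff Γ χ)
    {f h : 𝓢(EuclideanSpace ℝ (Fin n), ℂ)} (hfΓ : tsupport f ⊆ Γ) (hhΓ : tsupport h ⊆ Γ)
    (hpot : IsCutoffPotential hn k hχ (h : 𝓢'(EuclideanSpace ℝ (Fin n), ℂ))
      (f : 𝓢'(EuclideanSpace ℝ (Fin n), ℂ)))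
    (hf0 : 0 < ‖f.toLp 2‖) {M : ℝ} (hM : ‖h.toLp 2‖ ≤ M) :
    ENNReal.ofReal ((k : ℝ) ^ 2 * ‖f.toLp 2‖ / M) ≤ operatorNormA hn k hχ := by
  have hk := k.2
  obtain ⟨v, hv⟩ := exists_toDistribution_eq k 1 f
  obtain ⟨ψ, hψ⟩ := exists_toDistribution_eq k (-1) h
  rw [← hv, ← hψ] at hpot
  have hvn : (k : ℝ) * ‖f.toLp 2‖ ≤ ‖v‖ := mul_norm_toLp_le hv
  have hvpos : 0 < ‖v‖ := (mul_pos hk hf0).trans_le hvn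
  have hψn : ‖ψ‖ ≤ (k : ℝ)⁻¹ * M :=
    (norm_le_inv_mul_norm_toLp hψ).trans (mul_le_mul_of_nonneg_left hM (inv_nonneg.mpr hk.le))
  have hmem : ψ ∈ supportedIn n k (-1) Γ := mem_supportedIn hψ hΓ hhΓ
  obtain ⟨hψ0, hle⟩ := div_le_operatorNormA hn k hχ (ψ := ⟨ψ, hmem⟩)
    (mem_orthogonal_tildeSpace hv hfΓ) (norm_pos_iff.mp hvpos) hpot
  refine (ENNReal.ofReal_le_ofReal ?_).trans hle
  have hψpos : 0 < ‖ψ‖ := norm_pos_iff.mpr hψ0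
  have e : (k : ℝ) ^ 2 * ‖f.toLp 2‖ / M = (k * ‖f.toLp 2‖) / ((k : ℝ)⁻¹ * M) := by
    field_simp
  rw [e]
  exact div_le_div₀ (norm_nonneg _) hvn hψpos hψn

theorem exists_schwartz_tsupport_subset {U : Set (EuclideanSpace ℝ (Fin n))} (hU : IsOpen U)
    (hne : U.Nonempty) : ∃ g : 𝓢(EuclideanSpace ℝ (Fin n), ℂ), HasCompactSupport g ∧
      tsupport g ⊆ U ∧ 0 < ‖g.toLp 2‖ := by
  obtain ⟨x, hx⟩ := hne
  obtain ⟨f, hf, hfc, hfs, -, hf1⟩ := exists_contDiff_tsupport_subset (n := (⊤ : ℕ∞)) (hU.mem_nhds hx)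
  have hc : HasCompactSupport fun y => (f y : ℂ) := hfc.comp_left Complex.ofReal_zero
  have hs : ContDiff ℝ ∞ fun y => (f y : ℂ) := Complex.ofRealCLM.contDiff.comp hfs
  refine ⟨hc.toSchwartzMap hs, hc, ?_, ?_⟩
  · refine Set.Subset.trans ?_ hf
    exact closure_mono fun y hy h => hy (by simp [h])
  · rw [norm_pos_iff]
    intro h
    have h0 : hc.toSchwartzMap hs = 0 := by
      apply SchwartzMap.injective_toLp 2 volume
      refine Eq.trans h ?_
      exact (map_zero (SchwartzMap.toLpCLM ℂ ℂ 2 volume)).symm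
    have h1 : (f x : ℂ) = 0 := congrArg (fun g : 𝓢(EuclideanSpace ℝ (Fin n), ℂ) => g x) h0
    rw [hf1] at h1
    norm_num at h1

end

end Helmholtz

end

/-! ### The modulated test function and the constant -/

theorem proposition2p2 (n : ℕ) (hn : 2 ≤ n) (Γ : Set (EuclideanSpace ℝ (Fin n)))
    (hΓ : IsCompact Γ) (hint : (interior Γ).Nonempty) (k₀ : ℝ) (hk₀ : 0 < k₀) :
    ∃ c' : ℝ, 0 < c' ∧ ∀ k : Helmholtz.Wavenumber, k₀ ≤ (k : ℝ) →
      ∀ (χ : EuclideanSpace ℝ (Fin n) → ℂ) (hχ : Helmholtz.IsCutoff Γ χ),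
        ENNReal.ofReal (c' * (k : ℝ)) ≤ Helmholtz.operatorNormA hn k hχ := by
  obtain ⟨g, hg, hgΓ, hg0⟩ := Helmholtz.exists_schwartz_tsupport_subset isOpen_interior hint
  set d : EuclideanSpace ℝ (Fin n) := EuclideanSpace.basisFun (Fin n) ℝ ⟨0, by omega⟩
  have hd : ‖d‖ = 1 := OrthonormalBasis.norm_eq_one _ _
  set a : ℝ := ‖(Laplacian.laplacian g).toLp 2‖
  set b : ℝ := ‖(Helmholtz.directionalDeriv d g).toLp 2‖
  have ha : 0 ≤ a := norm_nonneg _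
  have hb : 0 ≤ b := norm_nonneg _
  -- For `k ≥ k₀`, `a + 2kb ≤ k(a/k₀ + 2b)`, so one of the two factors `k` in the lower bound
  -- survives. The summand 1 makes positivity of the denominator immediate.
  refine ⟨‖g.toLp 2‖ / (a / k₀ + 2 * b + 1), by positivity, fun k hk χ hχ => ?_⟩
  have hk0 := k.2
  have hsub : tsupport ⇑(Helmholtz.modulate k d g) ⊆ tsupport g := by
    refine closure_mono fun x hx h => hx ?_
    rw [Helmholtz.modulate_apply, h, mul_zero]
  have hM : a + 2 * k * b ≤ k * (a / k₀ + 2 * b + 1) := by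
    have : a ≤ k * (a / k₀) := by
      rw [mul_div_left_comm]
      exact le_mul_of_one_le_right ha ((one_le_div hk₀).mpr hk)
    nlinarith
  have hΓ' := hsub.trans (hgΓ.trans interior_subset)
  have h := Helmholtz.le_operatorNormA hn k hΓ.isClosed hχ hΓ'
    ((Helmholtz.tsupport_helmholtz_subset k _).trans hΓ')
    (Helmholtz.isCutoffPotential_of_helmholtz hn k hχ
      (hg.mono' ((subset_tsupport _).trans hsub)) hΓ')
    (by rwa [Helmholtz.norm_toLp_modulate])
    ((Helmholtz.norm_toLp_helmholtz_modulate_le hk0.le hd g).trans hM)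
  rw [Helmholtz.norm_toLp_modulate] at h
  convert h using 2
  field_simp
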